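/- **Setting (for a sample size $n\ge 0$).** Let $(X,A,Y)$ take values in $\mathcal X\times\mathbb R^{p}\times\mathcal Y$, where $\mathcal X,\mathcal Y$ are measurable spaces, let $f:\mathcal X\to\mathbb R^{d}$ be measurable and $\hat Y=f(X)$. Assume that $Y$ has a (jointly measurable, finite-valued) conditional density $q(y\mid a)$ given $A=a$ with respect to a $\sigma$-finite measure $\nu$ on $\mathcal Y$. Let $(X_i,A_i,Y_i)$, $i=1,\dots,n$, be i.i.d. copies of $(X,A,Y)$, and write $\mathbf X=(X_1,\dots,X_n)$, $\mathbf A=(A_1,\dots,A_n)$, $\mathbf Y=(Y_1,\dots,Y_n)$, $\hat{\mathbf Y}=(f(X_1),\dots,f(X_n))$. Let $S(\mathbf A)$ be the unordered collection (with duplicates) of the rows of $\mathbf A$. For a permutation $\pi$ of $\{1,\dots,n\}$ and $x=(x_1,\dots,x_n)$ put $x_\pi=(x_{\pi(1)},\dots,x_{\pi(n)})$, and let $q^n(y\mid a)=\prod_{i=1}^n q(y_i\mid a_i)$. Let $\Pi$ be a random permutation drawn, given the data $(\mathbf X,\mathbf A,\mathbf Y)$, according to $$\mathbb P\{\Pi=\pi\mid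 \mathbf X,\mathbf A,\mathbf Y\}=\frac{q^n(\mathbf Y_{\pi^{-1}}\mid \mathbf A)}{\sum_{\pi'}q^n(\mathbf Y_{\pi'^{-1}}\mid \mathbf A)}\quad\text{a.s.},$$ and let $\tilde{\mathbf A}=\mathbf A_\Pi$ (inverse conditional permutation). **Theorem 2.1.** In this setting the following hold. (1) If $\hat Y\perp A\mid Y$, then $(\hat{\mathbf Y},\mathbf A,\mathbf Y)$ and $(\hat{\mathbf Y},\tilde{\mathbf A},\mathbf Y)$ are equal in distribution. (2) (a) If $(\hat{\mathbf Y},\mathbf A,\mathbf Y)$ and $(\hat{\mathbf Y},\tilde{\mathbf A},\mathbf Y)$ are equal in distribution, then $\hat{\mathbf Y}\perp\mathbf A\mid(\mathbf Y,S(\mathbf A))$. (b) Consider a sequence of such settings, one for each sample size $n$, in which all the ingredients (the spaces, the law of $(X,A,Y)$, the function $f$, the density $q$, the reference measure $\nu$, the dimensions $p=p_n$ and $d=d_n$) may depend on $n$. Suppose that for all sufficiently large $n$ the equality in distribution of (a) holds, and that $\frac{\log p_n}{n}\to 0$. Then asymptotic equalized odds holds: for all constant vectors $t_1=t_1^{(n)}\in\mathbb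 R^{d_n}$ and $t_2=t_2^{(n)}\in\mathbb R^{p_n}$, $$\mathbb P[\hat Y\le t_1,\,A\le t_2\mid Y]-\mathbb P[\hat Y\le t_1\mid Y]\;\mathbb P[A\le t_2\mid Y]\longrightarrow 0\qquad(n\to\infty),$$ where inequalities between vectors are coordinatewise, $(\hat Y,A,Y)$ is one observation in the $n$-th setting, and the convergence is that of the essential supremum (with respect to the law of that observation) of the absolute value of the left-hand side. -/

import Mathlib

open MeasureTheory ProbabilityTheory Filter Topology
open scoped NNReal ENNReal

universe u v w

namespace FairICP

section Basic

variable {Ω β γ : Type*}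

/-- `U` and `V` are conditionally independent given the sub-σ-algebra `m`: for all measurable
`s, t`, `P(U ∈ s, V ∈ t | m) = P(U ∈ s | m) P(V ∈ t | m)` almost surely. It is Mathlib's
`CondIndepFun`, without the requirement that the underlying space be standard Borel
(see `condIndepFun_iff_condIndepGiven`). -/
def CondIndepGiven (m : MeasurableSpace Ω) [MeasurableSpace Ω] [MeasurableSpace β]
    [MeasurableSpace γ] (μ : Measure Ω) (U : Ω → β) (V : Ω → γ) : Prop :=
  ∀ (s : Set β) (t : Set γ), MeasurableSet s → MeasurableSet t →
    μ⟦U ⁻¹' s ∩ V ⁻¹' t | m⟧ =ᵐ[μ] fun ω => (μ⟦U ⁻¹' s | m⟧) ω * (μ⟦V ⁻¹' t | m⟧) ω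

theorem condIndepFun_iff_condIndepGiven (m : MeasurableSpace Ω) [mΩ : MeasurableSpace Ω]
    [StandardBorelSpace Ω] [MeasurableSpace β] [MeasurableSpace γ] (μ : Measure Ω)
    [IsFiniteMeasure μ] (hm : m ≤ mΩ) {U : Ω → β} {V : Ω → γ}
    (hU : Measurable U) (hV : Measurable V) :
    CondIndepFun m hm U V μ ↔ CondIndepGiven m μ U V :=
  condIndepFun_iff_condExp_inter_preimage_eq_mul hU hV

/-- The unordered collection `S(a) = {a₁, …, aₙ}` of the rows of `a`, duplicates allowed. -/
def unorderedRows {n : ℕ} (a : Fin n → β) : Multiset β :=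
  (Finset.univ : Finset (Fin n)).val.map a

/-- The quotient σ-algebra on unordered collections of `n` rows: a set of multisets is measurable
when the (permutation invariant) set of `n`-tuples lying over it is measurable. -/
abbrev rowsMeasurableSpace (n : ℕ) (β : Type*) [MeasurableSpace β] : MeasurableSpace (Multiset β) :=
  MeasurableSpace.map (unorderedRows (n := n)) inferInstance

/-- The permuted tuple `x_π = (x_{π(1)}, …, x_{π(n)})`. -/
def permute {n : ℕ} (x : Fin n → β) (π : Equiv.Perm (Fin n)) : Fin n → β := fun i => x (π i)

/-- The product density `qⁿ(y | a) = ∏ᵢ q(yᵢ | aᵢ)`, where `q a y` stands for `q(y | a)`. -/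
def prodDensity {n : ℕ} (q : β → γ → ℝ≥0) (a : Fin n → β) (y : Fin n → γ) : ℝ≥0 :=
  ∏ i, q (a i) (y i)

/-- The inverse conditional permutation probability
`qⁿ(y_{π⁻¹} | a) / ∑_{π'} qⁿ(y_{π'⁻¹} | a)` of the permutation `π`. -/
noncomputable def icpProb {n : ℕ} (q : β → γ → ℝ≥0) (a : Fin n → β) (y : Fin n → γ)
    (π : Equiv.Perm (Fin n)) : ℝ≥0 :=
  prodDensity q a (permute y π⁻¹) / ∑ π' : Equiv.Perm (Fin n), prodDensity q a (permute y π'⁻¹)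

/-- `q a y = q(y | a)` is a conditional density, with respect to `ν`, of the second coordinate given
the first one under the joint law `R`: `q` is jointly measurable and
`R(B × C) = ∫_B ∫_C q(y | a) ν(dy) R₁(da)`, where `R₁` is the first marginal of `R`. -/
def IsCondDensity [MeasurableSpace β] [MeasurableSpace γ] (R : Measure (β × γ)) (ν : Measure γ)
    (q : β → γ → ℝ≥0) : Prop :=
  Measurable (fun z : β × γ => q z.1 z.2) ∧
    R = (R.fst.prod ν).withDensity (fun z => (q z.1 z.2 : ℝ≥0∞))

end Basic

/-- The data of the method at sample size `n`: features in `𝒳`, sensitive attributes in `ℝᵖ`,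
responses in `𝒴`, predictions in `ℝᵈ`; `n` i.i.d. observations on the probability space `Ω`, and a
random permutation drawn from them by inverse conditional permutation. -/
structure Setting (𝒳 : Type u) (𝒴 : Type v) (Ω : Type w) [MeasurableSpace 𝒳] [MeasurableSpace 𝒴]
    [MeasurableSpace Ω] (n p d : ℕ) where
  /-- The population law of one observation `(X, A, Y)`. -/
  law : Measure (𝒳 × (Fin p → ℝ) × 𝒴)
  isProbabilityMeasure_law : IsProbabilityMeasure law
  /-- The prediction function, `Ŷ = f(X)`. -/
  f : 𝒳 → Fin d → ℝ
  measurable_f : Measurable f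
  /-- The reference measure for the densities of the response. -/
  ν : Measure 𝒴
  sigmaFinite_ν : SigmaFinite ν
  /-- `q a y = q(y | a)`, the conditional density of `Y` given `A = a`. -/
  q : (Fin p → ℝ) → 𝒴 → ℝ≥0
  isCondDensity_q : IsCondDensity law.snd ν q
  /-- The underlying probability. -/
  μ : Measure Ω
  isProbabilityMeasure_μ : IsProbabilityMeasure μ
  /-- The observed features, sensitive attributes and responses. -/
  X : Fin n → Ω → 𝒳
  A : Fin n → Ω → Fin p → ℝ
  Y : Fin n → Ω → 𝒴
  measurable_X : ∀ i, Measurable (X i)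
  measurable_A : ∀ i, Measurable (A i)
  measurable_Y : ∀ i, Measurable (Y i)
  /-- The observations are independent, each with the population law. -/
  iIndepFun_obs : iIndepFun (fun i ω => (X i ω, A i ω, Y i ω)) μ
  map_obs : ∀ i, μ.map (fun ω => (X i ω, A i ω, Y i ω)) = law
  /-- The random permutation. -/
  perm : Ω → Equiv.Perm (Fin n)
  measurableSet_perm : ∀ π, MeasurableSet (perm ⁻¹' {π})
  /-- Given the data, the permutation is drawn with the inverse conditional permutation
  probabilities, which are computed from `𝐀` and `𝐘` alone. -/
  condProb_perm : ∀ π,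
    μ⟦perm ⁻¹' {π} |
      MeasurableSpace.comap (fun ω i => (X i ω, A i ω, Y i ω))
        (inferInstance : MeasurableSpace (Fin n → 𝒳 × (Fin p → ℝ) × 𝒴))⟧
      =ᵐ[μ] fun ω => (icpProb q (fun i => A i ω) (fun i => Y i ω) π : ℝ)

namespace Setting

variable {𝒳 : Type u} {𝒴 : Type v} {Ω : Type w} [MeasurableSpace 𝒳] [MeasurableSpace 𝒴]
  [MeasurableSpace Ω] {n p d : ℕ} (M : Setting 𝒳 𝒴 Ω n p d)

/-- The sample `𝐀` of the sensitive attributes. -/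
def sampleA (ω : Ω) : Fin n → Fin p → ℝ := fun i => M.A i ω

/-- The sample `𝐘` of the responses. -/
def sampleY (ω : Ω) : Fin n → 𝒴 := fun i => M.Y i ω

/-- The sample `𝐘̂` of the predictions. -/
def sampleYhat (ω : Ω) : Fin n → Fin d → ℝ := fun i => M.f (M.X i ω)

/-- The permuted sample `𝐀̃` with rows `𝐀̃ᵢ = A_{Π(i)}`. -/
def sampleAtilde (ω : Ω) : Fin n → Fin p → ℝ := permute (M.sampleA ω) (M.perm ω)

/-- The σ-algebra generated by the response `Y` of one observation. -/
abbrev sigmaY (_M : Setting 𝒳 𝒴 Ω n p d) : MeasurableSpace (𝒳 × (Fin p → ℝ) × 𝒴) :=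
  MeasurableSpace.comap (fun z => z.2.2) (inferInstance : MeasurableSpace 𝒴)

/-- Equalized odds at the population level: `Ŷ ⫫ A | Y`. -/
def EqualizedOdds : Prop :=
  CondIndepGiven M.sigmaY M.law (fun z => M.f z.1) (fun z => z.2.1)

/-- `(𝐘̂, 𝐀, 𝐘)` and `(𝐘̂, 𝐀̃, 𝐘)` are equal in distribution. -/
def SameLaw : Prop :=
  IdentDistrib (fun ω => (M.sampleYhat ω, M.sampleA ω, M.sampleY ω))
    (fun ω => (M.sampleYhat ω, M.sampleAtilde ω, M.sampleY ω)) M.μ M.μ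

/-- The σ-algebra generated by `𝐘` and `S(𝐀)`. -/
abbrev sigmaYRows : MeasurableSpace Ω :=
  MeasurableSpace.comap M.sampleY inferInstance ⊔
    MeasurableSpace.comap (fun ω => unorderedRows (M.sampleA ω))
      (rowsMeasurableSpace n (Fin p → ℝ))

/-- The random variable
`P[Ŷ ≤ t₁, A ≤ t₂ | Y] - P[Ŷ ≤ t₁ | Y] P[A ≤ t₂ | Y]`, inequalities being coordinatewise. -/
noncomputable def cdfGap (t₁ : Fin d → ℝ) (t₂ : Fin p → ℝ) (z : 𝒳 × (Fin p → ℝ) × 𝒴) : ℝ :=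
  (M.law⟦{z | M.f z.1 ≤ t₁ ∧ z.2.1 ≤ t₂} | M.sigmaY⟧) z
    - (M.law⟦{z | M.f z.1 ≤ t₁} | M.sigmaY⟧) z * (M.law⟦{z | z.2.1 ≤ t₂} | M.sigmaY⟧) z

end Setting

end FairICP

/-! Everything is computed with densities relative to the product of the law of `A` and `ν`. Its
`n`-th power is invariant under permuting only the `A`-components, which the law of the pairs `(A,
Y)` need not be. Write `Q` for the product density of a tuple of pairs. If `(A, Y)` has density `gᵢ`
on the event `Ŷ ∈ sᵢ`, then on the event that every `Ŷᵢ ∈ sᵢ` the original pairs have density `∏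
gᵢ(zᵢ)`. The permuted pairs have density `Q(z) / ∑_σ Q(σz)` times `∑_π ∏ gᵢ((πz)ᵢ)`
(`map_pairs_restrict`, `map_pairsTilde_restrict`).

(1) Under equalized odds `gᵢ = q(y | a) κᵢ(y)`. The factor `∏ κᵢ(yᵢ)` ignores the order of the
`A`-rows, so the sum over `π` cancels the normalization and the two densities agree.

(2a) The conditional probability of `𝐀̃ ∈ t` given the data is a function of `(𝐀, 𝐘)` invariant
under permuting `𝐀`. Hence it is measurable for `σ(𝐘, S(𝐀))` (`measurableSet_sndRows_of_invariant`).
Equality in law lets it stand for the conditional probability of `𝐀 ∈ t`, and it factors out of that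
of the joint event.

(2b) For `n ≥ 2`, equality in law already forces exact equalized odds. Constrain only the first
prediction, writing its density as `q u`. Comparing a tuple with the one whose first two `A`-rows
are swapped gives `u(a, y) = u(a', y)` wherever both tuples have positive density
(`ae_eq_of_exchangeable`). Fubini arguments remove the auxiliary observations, so `u(·, y)` is
constant on `q(·, y) > 0` for almost every `y`. This constancy is conditional independence given
`Y`, and the gap is almost surely zero. -/

namespace FairICP

/-! ### Permuting only the first components -/

section PermuteFst

variable {α β : Type*}

/-- Permute the first components of a tuple of pairs, keeping the second components in place. -/
def permuteFst {n : ℕ} (π : Equiv.Perm (Fin n)) (z : Fin n → α × β) : Fin n → α × β :=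
  fun i => ((z (π i)).1, (z i).2)

theorem permuteFst_permuteFst {n : ℕ} (π σ : Equiv.Perm (Fin n)) (z : Fin n → α × β) :
    permuteFst π (permuteFst σ z) = permuteFst (σ * π) z := rfl

theorem permuteFst_one {n : ℕ} (z : Fin n → α × β) : permuteFst 1 z = z := rfl

end PermuteFst

/-! ### Densities and permutations on product measures -/

section ProductMeasures

variable {α β : Type*} [MeasurableSpace α] [MeasurableSpace β]

theorem lintegral_pi_prod_eq_prod {n : ℕ} (μ : Fin n → Measure α) [∀ i, SigmaFinite (μ i)]
    {g : Fin n → α → ℝ≥0∞} (hg : ∀ i, Measurable (g i)) :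
    ∫⁻ z, ∏ i, g i (z i) ∂Measure.pi μ = ∏ i, ∫⁻ x, g i x ∂μ i := by
  induction n with
  | zero => simp
  | succ n ih =>
    have e := measurePreserving_piFinSuccAbove μ 0
    have h : ∀ z : Fin (n + 1) → α, ∏ i, g i (z i) =
        (fun w : α × (Fin n → α) => g 0 w.1 * ∏ i : Fin n, g i.succ (w.2 i))
          (MeasurableEquiv.piFinSuccAbove (fun _ => α) 0 z) := by
      intro z
      simp [Fin.prod_univ_succ, MeasurableEquiv.piFinSuccAbove, Fin.tail]
    rw [lintegral_congr h]
    refine (e.lintegral_comp_emb (MeasurableEquiv.measurableEmbedding _)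
      fun w => g 0 w.1 * ∏ i : Fin n, g i.succ (w.2 i)).trans ?_
    have hm : Measurable fun w : Fin n → α => ∏ i : Fin n, g i.succ (w i) :=
      Finset.measurable_prod _ fun i _ => (hg _).comp (measurable_pi_apply i)
    rw [lintegral_prod_mul (hg 0).aemeasurable hm.aemeasurable]
    simp only [Fin.zero_succAbove]
    rw [ih (fun j => μ j.succ) (fun j => hg j.succ), Fin.prod_univ_succ]

theorem pi_withDensity {n : ℕ} (μ : Fin n → Measure α) [∀ i, SigmaFinite (μ i)]
    {g : Fin n → α → ℝ≥0∞} (hg : ∀ i, Measurable (g i))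
    [∀ i, SigmaFinite ((μ i).withDensity (g i))] :
    Measure.pi (fun i => (μ i).withDensity (g i)) =
      (Measure.pi μ).withDensity fun z => ∏ i, g i (z i) := by
  refine Measure.pi_eq fun s hs => ?_
  rw [withDensity_apply _ (MeasurableSet.univ_pi hs), Measure.restrict_pi_pi,
    lintegral_pi_prod_eq_prod _ hg]
  simp_rw [withDensity_apply _ (hs _)]

@[fun_prop]
theorem measurable_permuteFst {n : ℕ} (π : Equiv.Perm (Fin n)) :
    Measurable (permuteFst π : (Fin n → α × β) → _) := by
  unfold permuteFst; fun_prop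

/-- A power of `μ ⊗ ν` splits as `μⁿ ⊗ νⁿ`, and permuting coordinates preserves `μⁿ`. -/
theorem measurePreserving_permuteFst {n : ℕ} (π : Equiv.Perm (Fin n)) (μ : Measure α)
    (ν : Measure β) [SigmaFinite μ] [SigmaFinite ν] :
    MeasurePreserving (permuteFst π) (Measure.pi fun _ : Fin n => μ.prod ν)
      (Measure.pi fun _ : Fin n => μ.prod ν) := by
  have e := measurePreserving_arrowProdEquivProdArrow α β (Fin n) (fun _ => μ) (fun _ => ν)
  have c := measurePreserving_piCongrLeft (α := fun _ : Fin n => α) (fun _ => μ) π.symm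
  have := (e.symm _).comp ((c.prod (MeasurePreserving.id _)).comp e)
  convert this using 1
  funext z i
  have h : (MeasurableEquiv.piCongrLeft (fun _ : Fin n => α) π.symm (fun j => (z j).1)) i
      = (z (π i)).1 := by
    obtain ⟨j, rfl⟩ := π.symm.surjective i
    rw [MeasurableEquiv.coe_piCongrLeft, Equiv.piCongrLeft_apply_apply]
    simp
  exact Prod.ext h.symm rfl

end ProductMeasures

/-! ### Algebra of the permutation probabilities -/

section Weights

variable {α β : Type*}

/-- The product density `∏ᵢ q(yᵢ | aᵢ)` as a function of the tuple of pairs `(aᵢ, yᵢ)`. -/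
def tupleDensity {n : ℕ} (q : α → β → ℝ≥0) (z : Fin n → α × β) : ℝ≥0 :=
  ∏ i, q (z i).1 (z i).2

/-- Reindexing the product by the permutation turns its inverse acting on the responses into the
permutation acting on the attributes. -/
theorem icpProb_eq_tupleDensity {n : ℕ} (q : α → β → ℝ≥0) (z : Fin n → α × β)
    (π : Equiv.Perm (Fin n)) :
    icpProb q (fun i => (z i).1) (fun i => (z i).2) π =
      tupleDensity q (permuteFst π z) / ∑ σ, tupleDensity q (permuteFst σ z) := by
  have h : ∀ σ : Equiv.Perm (Fin n),
      prodDensity q (fun i => (z i).1) (permute (fun i => (z i).2) σ⁻¹) =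
        tupleDensity q (permuteFst σ z) := by
    intro σ
    unfold prodDensity permute tupleDensity permuteFst
    rw [← Equiv.prod_comp σ]
    simp
  simp only [icpProb, h]

/-- The normalizing sum runs over a whole orbit, so it is unchanged. The right side no longer
depends on `π`: this common factor comes out of the sum over permutations in the density of the
permuted pairs. -/
theorem icpProb_permuteFst_inv {n : ℕ} (q : α → β → ℝ≥0) (z : Fin n → α × β)
    (π : Equiv.Perm (Fin n)) :
    icpProb q (fun i => (permuteFst π⁻¹ z i).1) (fun i => (permuteFst π⁻¹ z i).2) π =
      tupleDensity q z / ∑ σ, tupleDensity q (permuteFst σ z) := by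
  rw [icpProb_eq_tupleDensity]
  simp only [permuteFst_permuteFst, inv_mul_cancel, permuteFst_one]
  congr 1
  exact Equiv.sum_comp (Equiv.mulLeft π⁻¹) fun τ => tupleDensity q (permuteFst τ z)

theorem icpProb_permuteFst {n : ℕ} (q : α → β → ℝ≥0) (z : Fin n → α × β)
    (σ π : Equiv.Perm (Fin n)) :
    icpProb q (fun i => (permuteFst σ z i).1) (fun i => (permuteFst σ z i).2) π =
      icpProb q (fun i => (z i).1) (fun i => (z i).2) (σ * π) := by
  simp only [icpProb_eq_tupleDensity, permuteFst_permuteFst]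
  congr 1
  exact Equiv.sum_comp (Equiv.mulLeft σ) fun τ => tupleDensity q (permuteFst τ z)

theorem icpProb_le_one {n : ℕ} (q : α → β → ℝ≥0) (a : Fin n → α) (y : Fin n → β)
    (π : Equiv.Perm (Fin n)) : icpProb q a y π ≤ 1 := by
  unfold icpProb
  -- This bound also covers a zero denominator, where the quotient is zero by convention.
  apply div_le_one_of_le₀ _ zero_le
  exact Finset.single_le_sum (f := fun π' : Equiv.Perm (Fin n) =>
    prodDensity q a (permute y π'⁻¹)) (fun _ _ => zero_le) (Finset.mem_univ π)

theorem measurable_tupleDensity [MeasurableSpace α] [MeasurableSpace β] {n : ℕ}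
    {q : α → β → ℝ≥0} (hq : Measurable fun z : α × β => q z.1 z.2) :
    Measurable (tupleDensity (n := n) q) :=
  Finset.measurable_prod _ fun i _ => hq.comp (measurable_pi_apply i)

theorem measurable_icpProb [MeasurableSpace α] [MeasurableSpace β] {n : ℕ}
    {q : α → β → ℝ≥0} (hq : Measurable fun z : α × β => q z.1 z.2) (π : Equiv.Perm (Fin n)) :
    Measurable fun z : Fin n → α × β =>
      icpProb q (fun i => (z i).1) (fun i => (z i).2) π := by
  simp_rw [icpProb_eq_tupleDensity]
  have h := measurable_tupleDensity (n := n) hq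
  exact (h.comp (measurable_permuteFst π)).div
    (Finset.measurable_sum _ fun σ _ => h.comp (measurable_permuteFst σ))

end Weights

/-! ### The sample, the random permutation and the laws of the pairs -/

namespace Setting

variable {𝒳 : Type u} {𝒴 : Type v} {Ω : Type w} [MeasurableSpace 𝒳] [MeasurableSpace 𝒴]
  [MeasurableSpace Ω] {n p d : ℕ} (M : Setting 𝒳 𝒴 Ω n p d)

attribute [instance] isProbabilityMeasure_law isProbabilityMeasure_μ sigmaFinite_ν

/-- The sample of all observations. -/
def data (ω : Ω) : Fin n → 𝒳 × (Fin p → ℝ) × 𝒴 := fun i => (M.X i ω, M.A i ω, M.Y i ω)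

/-- The sample of the pairs `(Aᵢ, Yᵢ)`. -/
def pairs (ω : Ω) : Fin n → (Fin p → ℝ) × 𝒴 := fun i => (M.A i ω, M.Y i ω)

/-- The sample of the pairs `(Ãᵢ, Yᵢ)`. -/
def pairsTilde (ω : Ω) : Fin n → (Fin p → ℝ) × 𝒴 := permuteFst (M.perm ω) (M.pairs ω)

/-- The probability of drawing `π`, as a function of the pairs `(Aᵢ, Yᵢ)`. -/
noncomputable def weight (π : Equiv.Perm (Fin n)) (z : Fin n → (Fin p → ℝ) × 𝒴) : ℝ≥0 :=
  icpProb M.q (fun i => (z i).1) (fun i => (z i).2) π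

/-- The product of the law of `A` and the reference measure `ν`. -/
noncomputable def base : Measure ((Fin p → ℝ) × 𝒴) := M.law.snd.fst.prod M.ν

instance : SigmaFinite M.base := by unfold base; infer_instance

theorem measurable_data : Measurable M.data :=
  measurable_pi_lambda _ fun i =>
    (M.measurable_X i).prodMk ((M.measurable_A i).prodMk (M.measurable_Y i))

theorem measurable_pairs : Measurable M.pairs :=
  measurable_pi_lambda _ fun i => (M.measurable_A i).prodMk (M.measurable_Y i)

theorem measurable_sampleA : Measurable M.sampleA :=
  measurable_pi_lambda _ fun i => M.measurable_A i

theorem measurable_sampleY : Measurable M.sampleY :=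
  measurable_pi_lambda _ fun i => M.measurable_Y i

theorem measurable_sampleYhat : Measurable M.sampleYhat :=
  measurable_pi_lambda _ fun i => M.measurable_f.comp (M.measurable_X i)

theorem measurable_perm_apply {γ : Type*} [MeasurableSpace γ] {F : Equiv.Perm (Fin n) → Ω → γ}
    (hF : ∀ π, Measurable (F π)) : Measurable fun ω => F (M.perm ω) ω := by
  intro T hT
  have h : (fun ω => F (M.perm ω) ω) ⁻¹' T = ⋃ π, M.perm ⁻¹' {π} ∩ F π ⁻¹' T := by
    ext ω; simp
  rw [h]
  exact MeasurableSet.iUnion fun π => (M.measurableSet_perm π).inter (hF π hT)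

theorem measurable_sampleAtilde : Measurable M.sampleAtilde :=
  M.measurable_perm_apply (F := fun π ω => permute (M.sampleA ω) π) fun π =>
    measurable_pi_lambda _ fun i => M.measurable_A (π i)

theorem measurable_pairsTilde : Measurable M.pairsTilde :=
  M.measurable_perm_apply (F := fun π ω => permuteFst π (M.pairs ω)) fun π =>
    (measurable_permuteFst π).comp M.measurable_pairs

theorem measurable_q : Measurable fun z : (Fin p → ℝ) × 𝒴 => M.q z.1 z.2 :=
  M.isCondDensity_q.1

theorem measurable_weight (π : Equiv.Perm (Fin n)) : Measurable (M.weight π) :=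
  measurable_icpProb M.measurable_q π

theorem map_snd_law :
    M.law.map Prod.snd = M.base.withDensity fun z => (M.q z.1 z.2 : ℝ≥0∞) :=
  M.isCondDensity_q.2

theorem map_data : M.μ.map M.data = Measure.pi fun _ => M.law := by
  have h := (iIndepFun_iff_map_fun_eq_pi_map fun i => ((M.measurable_X i).prodMk
    ((M.measurable_A i).prodMk (M.measurable_Y i))).aemeasurable).1 M.iIndepFun_obs
  simp only [M.map_obs] at h
  exact h

/-- The defining property of the conditional probability of `Π = π`, integrated over events of the
data and stated as an identity of measures. -/
theorem map_restrict_perm (π : Equiv.Perm (Fin n)) :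
    (M.μ.restrict (M.perm ⁻¹' {π})).map M.data =
      (M.μ.withDensity fun ω => (M.weight π (M.pairs ω) : ℝ≥0∞)).map M.data := by
  ext B hB
  have hm := M.measurable_data hB
  have hle := M.measurable_data.comap_le
  have hw : Measurable fun ω => M.weight π (M.pairs ω) :=
    (M.measurable_weight π).comp M.measurable_pairs
  rw [Measure.map_apply M.measurable_data hB, Measure.map_apply M.measurable_data hB,
    Measure.restrict_apply hm, withDensity_apply _ hm]
  have h1 : Integrable ((M.perm ⁻¹' {π}).indicator fun _ => (1 : ℝ)) M.μ :=
    (integrable_const 1).indicator (M.measurableSet_perm π)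
  have h2 := setIntegral_condExp hle h1 (s := M.data ⁻¹' B) ⟨B, hB, rfl⟩
  have h5 := setIntegral_congr_ae (s := M.data ⁻¹' B) hm
    ((M.condProb_perm π).mono fun ω h _ => h)
  replace h2 := h5.symm.trans h2
  rw [integral_indicator_const (1 : ℝ) (M.measurableSet_perm π)] at h2
  have h3 : M.μ.real (M.data ⁻¹' B ∩ M.perm ⁻¹' {π}) =
      ∫ ω in M.data ⁻¹' B, (M.weight π (M.pairs ω) : ℝ) ∂M.μ := by
    rw [Set.inter_comm, ← measureReal_restrict_apply (M.measurableSet_perm π)]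
    simpa [weight, pairs] using h2.symm
  have h4 : ∀ ω, (M.weight π (M.pairs ω) : ℝ≥0∞) =
      ENNReal.ofReal (M.weight π (M.pairs ω) : ℝ) := fun ω => by simp
  rw [lintegral_congr h4, ← ofReal_integral_eq_lintegral_ofReal _ (ae_of_all _ fun ω => by simp),
    ← h3, ofReal_measureReal]
  refine Integrable.of_bound (C := 1) hw.coe_nnreal_real.aestronglyMeasurable
    (ae_of_all _ fun ω => ?_)
  simpa [weight] using icpProb_le_one _ _ _ _

theorem lintegral_perm {F : Equiv.Perm (Fin n) → (Fin n → 𝒳 × (Fin p → ℝ) × 𝒴) → ℝ≥0∞}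
    (hF : ∀ π, Measurable (F π)) :
    ∫⁻ ω, F (M.perm ω) (M.data ω) ∂M.μ =
      ∑ π, ∫⁻ ω, (M.weight π (M.pairs ω) : ℝ≥0∞) * F π (M.data ω) ∂M.μ := by
  have h : ∀ ω, F (M.perm ω) (M.data ω) =
      ∑ π, (M.perm ⁻¹' {π}).indicator (fun ω => F π (M.data ω)) ω := by
    intro ω
    rw [Finset.sum_eq_single (M.perm ω)] <;> simp +contextual [eq_comm]
  have hm : ∀ π, Measurable ((M.perm ⁻¹' {π}).indicator fun ω => F π (M.data ω)) := fun π =>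
    ((hF π).comp M.measurable_data).indicator (M.measurableSet_perm π)
  rw [lintegral_congr h, lintegral_finsetSum _ fun π _ => hm π]
  refine Finset.sum_congr rfl fun π _ => ?_
  have hw : Measurable fun ω => (M.weight π (M.pairs ω) : ℝ≥0∞) :=
    ((M.measurable_weight π).comp M.measurable_pairs).coe_nnreal_ennreal
  rw [lintegral_indicator (M.measurableSet_perm π), ← lintegral_map (hF π) M.measurable_data,
    M.map_restrict_perm, lintegral_map (hF π) M.measurable_data]
  exact lintegral_withDensity_eq_lintegral_mul _ hw ((hF π).comp M.measurable_data)

theorem measure_sampleYhat_pairsTilde {S : Set (Fin n → Fin d → ℝ)} (hS : MeasurableSet S)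
    {T : Set (Fin n → (Fin p → ℝ) × 𝒴)} (hT : MeasurableSet T) :
    M.μ (M.sampleYhat ⁻¹' S ∩ M.pairsTilde ⁻¹' T) =
      ∑ π, ∫⁻ ω in M.sampleYhat ⁻¹' S,
        (M.weight π (M.pairs ω) : ℝ≥0∞) * T.indicator 1 (permuteFst π (M.pairs ω)) ∂M.μ := by
  have hp : ∀ π : Equiv.Perm (Fin n), Measurable fun x : Fin n → 𝒳 × (Fin p → ℝ) × 𝒴 =>
      permuteFst π fun i => (x i).2 := fun π =>
    (measurable_permuteFst π).comp (measurable_pi_lambda _ fun i =>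
      measurable_snd.comp (measurable_pi_apply i))
  have hf : Measurable fun (x : Fin n → 𝒳 × (Fin p → ℝ) × 𝒴) i => M.f (x i).1 :=
    measurable_pi_lambda _ fun i => M.measurable_f.comp (measurable_fst.comp (measurable_pi_apply i))
  have key := M.lintegral_perm (F := fun π x =>
      S.indicator 1 (fun i => M.f (x i).1) * T.indicator 1 (permuteFst π fun i => (x i).2))
    fun π => ((measurable_one.indicator hS).comp hf).mul ((measurable_one.indicator hT).comp (hp π))
  have h1 : ∀ ω, S.indicator (1 : (Fin n → Fin d → ℝ) → ℝ≥0∞) (fun i => M.f (M.data ω i).1) *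
      T.indicator 1 (permuteFst (M.perm ω) fun i => (M.data ω i).2) =
      (M.sampleYhat ⁻¹' S ∩ M.pairsTilde ⁻¹' T).indicator 1 ω := by
    intro ω
    rw [Set.inter_indicator_one]
    rfl
  rw [lintegral_congr h1, lintegral_indicator_one
    ((M.measurable_sampleYhat hS).inter (M.measurable_pairsTilde hT))] at key
  rw [key]
  refine Finset.sum_congr rfl fun π _ => ?_
  rw [← lintegral_indicator (M.measurable_sampleYhat hS)]
  refine lintegral_congr fun ω => ?_
  have e : S.indicator (1 : (Fin n → Fin d → ℝ) → ℝ≥0∞) (fun i => M.f (M.data ω i).1) =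
      (M.sampleYhat ⁻¹' S).indicator 1 ω := rfl
  have e' : (fun i => (M.data ω i).2) = M.pairs ω := rfl
  rw [e, e']
  by_cases h : ω ∈ M.sampleYhat ⁻¹' S
  · rw [Set.indicator_of_mem h, Set.indicator_of_mem h, Pi.one_apply, one_mul]
  · rw [Set.indicator_of_notMem h, Set.indicator_of_notMem h, zero_mul, mul_zero]

theorem SameLaw.measure_eq {M : Setting 𝒳 𝒴 Ω n p d} (h : M.SameLaw)
    {S : Set (Fin n → Fin d → ℝ)} (hS : MeasurableSet S)
    {T : Set (Fin n → (Fin p → ℝ) × 𝒴)} (hT : MeasurableSet T) :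
    M.μ (M.sampleYhat ⁻¹' S ∩ M.pairs ⁻¹' T) = M.μ (M.sampleYhat ⁻¹' S ∩ M.pairsTilde ⁻¹' T) := by
  have hz : Measurable fun (x : (Fin n → Fin p → ℝ) × (Fin n → 𝒴)) i => (x.1 i, x.2 i) := by
    fun_prop
  exact IdentDistrib.measure_mem_eq h (hS.prod (hz hT))

/-- Boxes generate the σ-algebra of prediction tuples and form a π-system. They suffice for `𝐘̂`,
and on them the i.i.d. law factors. -/
theorem sameLaw_of_measure_eq
    (h : ∀ s : Fin n → Set (Fin d → ℝ), (∀ i, MeasurableSet (s i)) →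
      ∀ T : Set (Fin n → (Fin p → ℝ) × 𝒴), MeasurableSet T →
        M.μ (M.sampleYhat ⁻¹' Set.univ.pi s ∩ M.pairs ⁻¹' T) =
          M.μ (M.sampleYhat ⁻¹' Set.univ.pi s ∩ M.pairsTilde ⁻¹' T)) :
    M.SameLaw := by
  have hm1 : Measurable fun ω => (M.sampleYhat ω, M.sampleA ω, M.sampleY ω) :=
    M.measurable_sampleYhat.prodMk (M.measurable_sampleA.prodMk M.measurable_sampleY)
  have hm2 : Measurable fun ω => (M.sampleYhat ω, M.sampleAtilde ω, M.sampleY ω) :=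
    M.measurable_sampleYhat.prodMk (M.measurable_sampleAtilde.prodMk M.measurable_sampleY)
  refine ⟨hm1.aemeasurable, hm2.aemeasurable, ?_⟩
  have := Measure.isFiniteMeasure_map M.μ fun ω => (M.sampleYhat ω, M.sampleA ω, M.sampleY ω)
  refine Measure.ext_prod fun {S T'} hS hT' => ?_
  rw [Measure.map_apply hm1 (hS.prod hT'), Measure.map_apply hm2 (hS.prod hT')]
  have hu : Measurable fun z : Fin n → (Fin p → ℝ) × 𝒴 =>
      ((fun i => (z i).1 : Fin n → Fin p → ℝ), (fun i => (z i).2 : Fin n → 𝒴)) := by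
    fun_prop
  have hT := hu hT'
  set T := (fun z : Fin n → (Fin p → ℝ) × 𝒴 =>
    ((fun i => (z i).1 : Fin n → Fin p → ℝ), (fun i => (z i).2 : Fin n → 𝒴))) ⁻¹' T'
  have e : (M.μ.restrict (M.pairs ⁻¹' T)).map M.sampleYhat =
      (M.μ.restrict (M.pairsTilde ⁻¹' T)).map M.sampleYhat := by
    refine ext_of_generate_finite _ generateFrom_pi.symm isPiSystem_pi ?_ ?_
    · rintro _ ⟨s, hs, rfl⟩
      have hs' : ∀ i, MeasurableSet (s i) := fun i => hs i (Set.mem_univ i)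
      rw [Measure.map_apply M.measurable_sampleYhat (MeasurableSet.univ_pi hs'),
        Measure.map_apply M.measurable_sampleYhat (MeasurableSet.univ_pi hs'),
        Measure.restrict_apply (M.measurable_sampleYhat (MeasurableSet.univ_pi hs')),
        Measure.restrict_apply (M.measurable_sampleYhat (MeasurableSet.univ_pi hs'))]
      exact h s hs' _ hT
    · have := h (fun _ => Set.univ) (fun _ => MeasurableSet.univ) _ hT
      rw [Measure.map_apply M.measurable_sampleYhat .univ,
        Measure.map_apply M.measurable_sampleYhat .univ]
      simpa using this
  have e' := DFunLike.congr_fun e S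
  rw [Measure.map_apply M.measurable_sampleYhat hS, Measure.map_apply M.measurable_sampleYhat hS,
    Measure.restrict_apply (M.measurable_sampleYhat hS),
    Measure.restrict_apply (M.measurable_sampleYhat hS)] at e'
  exact e'

section Densities

variable {s : Fin n → Set (Fin d → ℝ)} {g : Fin n → (Fin p → ℝ) × 𝒴 → ℝ≥0∞}

/-- Restricting an i.i.d. sample to a box leaves a product measure, so each coordinate can be
handled separately. -/
theorem map_pairs_restrict (hs : ∀ i, MeasurableSet (s i)) (hg : ∀ i, Measurable (g i))
    (h : ∀ i, (M.law.restrict {x | M.f x.1 ∈ s i}).map Prod.snd = M.base.withDensity (g i)) :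
    (M.μ.restrict (M.sampleYhat ⁻¹' Set.univ.pi s)).map M.pairs =
      (Measure.pi fun _ => M.base).withDensity fun z => ∏ i, g i (z i) := by
  have hsm : ∀ i, MeasurableSet {x : 𝒳 × (Fin p → ℝ) × 𝒴 | M.f x.1 ∈ s i} := fun i =>
    M.measurable_f.comp measurable_fst (hs i)
  have hfin : ∀ i, IsFiniteMeasure (M.base.withDensity (g i)) := fun i => by
    rw [← h]; infer_instance
  have hset : M.sampleYhat ⁻¹' Set.univ.pi s =
      M.data ⁻¹' Set.univ.pi fun i => {x | M.f x.1 ∈ s i} := by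
    ext ω; simp [sampleYhat, data]
  have hsnd : Measurable fun (x : Fin n → 𝒳 × (Fin p → ℝ) × 𝒴) i => (x i).2 := by fun_prop
  rw [← pi_withDensity _ hg, hset, show M.pairs = (fun x i => (x i).2) ∘ M.data from rfl,
    ← Measure.map_map hsnd M.measurable_data,
    ← Measure.restrict_map M.measurable_data (MeasurableSet.univ_pi hsm), M.map_data,
    Measure.restrict_pi_pi, Measure.pi_map_pi fun i => measurable_snd.aemeasurable]
  simp_rw [h]

theorem map_pairsTilde_restrict (hs : ∀ i, MeasurableSet (s i)) (hg : ∀ i, Measurable (g i))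
    (h : ∀ i, (M.law.restrict {x | M.f x.1 ∈ s i}).map Prod.snd = M.base.withDensity (g i)) :
    (M.μ.restrict (M.sampleYhat ⁻¹' Set.univ.pi s)).map M.pairsTilde =
      (Measure.pi fun _ => M.base).withDensity fun z =>
        ((tupleDensity M.q z / ∑ σ, tupleDensity M.q (permuteFst σ z) : ℝ≥0) : ℝ≥0∞) *
          ∑ π, ∏ i, g i (permuteFst π z i) := by
  have hgm : Measurable fun z : Fin n → (Fin p → ℝ) × 𝒴 => ∏ i, g i (z i) :=
    Finset.measurable_prod _ fun i _ => (hg i).comp (measurable_pi_apply i)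
  ext T hT
  have hw : ∀ π, Measurable fun z : Fin n → (Fin p → ℝ) × 𝒴 =>
      (M.weight π z : ℝ≥0∞) * T.indicator 1 (permuteFst π z) := fun π =>
    (M.measurable_weight π).coe_nnreal_ennreal.mul
      ((measurable_one.indicator hT).comp (measurable_permuteFst π))
  have hr : Measurable fun z : Fin n → (Fin p → ℝ) × 𝒴 =>
      ((tupleDensity M.q z / ∑ σ, tupleDensity M.q (permuteFst σ z) : ℝ≥0) : ℝ≥0∞) := by
    have hq := measurable_tupleDensity (n := n) M.measurable_q
    exact (hq.div (Finset.measurable_sum _ fun σ _ =>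
      hq.comp (measurable_permuteFst σ))).coe_nnreal_ennreal
  rw [Measure.map_apply M.measurable_pairsTilde hT,
    Measure.restrict_apply (M.measurable_pairsTilde hT), Set.inter_comm,
    M.measure_sampleYhat_pairsTilde (MeasurableSet.univ_pi hs) hT, withDensity_apply _ hT,
    ← lintegral_indicator hT]
  have hterm : ∀ π, ∫⁻ ω in M.sampleYhat ⁻¹' Set.univ.pi s,
      (M.weight π (M.pairs ω) : ℝ≥0∞) * T.indicator 1 (permuteFst π (M.pairs ω)) ∂M.μ =
      ∫⁻ z, T.indicator 1 z * (((tupleDensity M.q z /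
        ∑ σ, tupleDensity M.q (permuteFst σ z) : ℝ≥0) : ℝ≥0∞) * ∏ i, g i (permuteFst π⁻¹ z i))
        ∂(Measure.pi fun _ => M.base) := by
    intro π
    rw [← lintegral_map (hw π) M.measurable_pairs, M.map_pairs_restrict hs hg h,
      lintegral_withDensity_eq_lintegral_mul _ hgm (hw π)]
    -- Substituting `π⁻¹z` for `z` turns the permuted tuple inside the indicator into `z`, and the
    -- weight into the factor common to all `π`.
    refine ((measurePreserving_permuteFst π⁻¹ M.law.snd.fst M.ν).lintegral_comp
      (hgm.mul (hw π))).symm.trans (lintegral_congr fun z => ?_)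
    have e := icpProb_permuteFst_inv M.q z π
    simp only [Pi.mul_apply, permuteFst_permuteFst, inv_mul_cancel, permuteFst_one, weight, e]
    ring
  simp_rw [hterm]
  have hgp : ∀ π : Equiv.Perm (Fin n), Measurable fun z : Fin n → (Fin p → ℝ) × 𝒴 =>
      ∏ i, g i (permuteFst π z i) := fun π => hgm.comp (measurable_permuteFst π)
  refine (Equiv.sum_comp (Equiv.inv _) fun π => ∫⁻ z, T.indicator 1 z * (((tupleDensity M.q z /
    ∑ σ, tupleDensity M.q (permuteFst σ z) : ℝ≥0) : ℝ≥0∞) * ∏ i, g i (permuteFst π z i))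
    ∂(Measure.pi fun _ => M.base)).trans ?_
  refine (lintegral_finsetSum _ fun π _ =>
    (measurable_one.indicator hT).mul (hr.mul (hgp π))).symm.trans ?_
  refine lintegral_congr fun z => ?_
  simp only [Pi.mul_apply]
  rw [← Finset.mul_sum, ← Finset.mul_sum]
  by_cases hz : z ∈ T <;> simp [hz]

end Densities

end Setting

/-! ### Conditional probabilities as densities -/

section CondProb

variable {Ω β : Type*} [MeasurableSpace Ω] [mβ : MeasurableSpace β]

/-- A conditional probability given `Y` is a function of `Y`, the density of the law of `Y` on the
event with respect to the law of `Y`. -/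
theorem exists_condProb_density (μ : Measure Ω) [IsProbabilityMeasure μ] {Y : Ω → β}
    (hY : Measurable Y) {E : Set Ω} (hE : MeasurableSet E) :
    ∃ κ : β → ℝ≥0∞, Measurable κ ∧ (∀ y, κ y ≠ ∞) ∧
      μ⟦E | mβ.comap Y⟧ =ᵐ[μ] (fun ω => (κ (Y ω)).toReal) ∧
      (μ.restrict E).map Y = (μ.map Y).withDensity κ := by
  have hle := hY.comap_le
  have hmeas : Measurable[mβ.comap Y] (μ⟦E | mβ.comap Y⟧) :=
    stronglyMeasurable_condExp.measurable
  obtain ⟨κ, hκ, hκe⟩ := hmeas.exists_eq_measurable_comp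
  have hnn : 0 ≤ᵐ[μ] μ⟦E | mβ.comap Y⟧ := condExp_nonneg (ae_of_all _ fun ω =>
    Set.indicator_nonneg (fun _ _ => zero_le_one) ω)
  refine ⟨fun y => ENNReal.ofReal (κ y), hκ.ennreal_ofReal, fun y => ENNReal.ofReal_ne_top, ?_, ?_⟩
  · filter_upwards [hnn] with ω hω
    rw [hκe] at hω ⊢
    exact (ENNReal.toReal_ofReal hω).symm
  · ext C hC
    have h1 : Integrable (E.indicator fun _ => (1 : ℝ)) μ := (integrable_const 1).indicator hE
    have h2 := setIntegral_condExp hle h1 (s := Y ⁻¹' C) ⟨C, hC, rfl⟩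
    rw [integral_indicator_const (1 : ℝ) hE, smul_eq_mul, mul_one] at h2
    rw [Measure.map_apply hY hC, withDensity_apply _ hC, Measure.restrict_apply (hY hC),
      setLIntegral_map hC hκ.ennreal_ofReal hY]
    have h3 : ∀ ω, ENNReal.ofReal (κ (Y ω)) = ENNReal.ofReal ((μ⟦E | mβ.comap Y⟧) ω) := fun ω => by
      rw [hκe]; rfl
    rw [lintegral_congr h3, ← ofReal_integral_eq_lintegral_ofReal
      integrable_condExp.integrableOn (ae_restrict_of_ae hnn), h2, ofReal_measureReal,
      Measure.restrict_apply hE, Set.inter_comm]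

end CondProb

/-! ### From exchangeability to constancy in the attribute -/

section Exchange

variable {α β : Type*} [MeasurableSpace α] [MeasurableSpace β]

theorem map_snd_restrict_fst_withDensity (P : Measure α) (ν : Measure β) [SFinite P] [SFinite ν]
    {G : α × β → ℝ≥0∞} (hG : Measurable G) {t : Set α} (ht : MeasurableSet t) :
    (((P.prod ν).withDensity G).restrict (Prod.fst ⁻¹' t)).map Prod.snd =
      ν.withDensity fun y => ∫⁻ a in t, G (a, y) ∂P := by
  ext C hC
  have h : Prod.snd ⁻¹' C ∩ Prod.fst ⁻¹' t = t ×ˢ C := by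
    ext x; simp [and_comm]
  rw [Measure.map_apply measurable_snd hC, Measure.restrict_apply (measurable_snd hC), h,
    withDensity_apply _ (ht.prod hC), withDensity_apply _ hC, ← Measure.prod_restrict,
    lintegral_prod_symm _ hG.aemeasurable]

/-- If the symmetrization of `u (a₀, y₀)` with the inverse conditional permutation weights changes
nothing, then `u (a₀, y₀) = u (a₁, y₀)` whenever the first two rows can be exchanged. -/
theorem ae_eq_of_exchangeable {m : ℕ} (P : Measure α) (ν : Measure β) [SigmaFinite P]
    [SigmaFinite ν] {q : α → β → ℝ≥0} {u : α × β → ℝ≥0∞}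
    (h : ∀ᵐ z ∂(Measure.pi fun _ : Fin (m + 2) => P.prod ν),
      (tupleDensity q z : ℝ≥0∞) * u (z 0) =
        ((tupleDensity q z / ∑ σ, tupleDensity q (permuteFst σ z) : ℝ≥0) : ℝ≥0∞) *
          ∑ π, (tupleDensity q (permuteFst π z) : ℝ≥0∞) * u (permuteFst π z 0)) :
    ∀ᵐ z ∂(Measure.pi fun _ : Fin (m + 2) => P.prod ν), tupleDensity q z ≠ 0 →
      tupleDensity q (permuteFst (Equiv.swap 0 1) z) ≠ 0 → u (z 0) = u ((z 1).1, (z 0).2) := by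
  let S : (Fin (m + 2) → α × β) → ℝ≥0 := fun z => ∑ σ, tupleDensity q (permuteFst σ z)
  let N : (Fin (m + 2) → α × β) → ℝ≥0∞ := fun z =>
    ∑ π, (tupleDensity q (permuteFst π z) : ℝ≥0∞) * u (permuteFst π z 0)
  have hS : ∀ τ z, S (permuteFst τ z) = S z := fun τ z =>
    Equiv.sum_comp (Equiv.mulLeft τ) fun σ => tupleDensity q (permuteFst σ z)
  have hN : ∀ τ z, N (permuteFst τ z) = N z := fun τ z =>
    Equiv.sum_comp (Equiv.mulLeft τ) fun π =>
      (tupleDensity q (permuteFst π z) : ℝ≥0∞) * u (permuteFst π z 0)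
  -- Cancelling the density expresses `u (z 0)` through `S` and `N`, both invariant under permuting
  -- the first components.
  have key : ∀ᵐ z ∂(Measure.pi fun _ : Fin (m + 2) => P.prod ν), tupleDensity q z ≠ 0 →
      u (z 0) = ((S z)⁻¹ : ℝ≥0) * N z := by
    filter_upwards [h] with z hz hq
    have hq' : (tupleDensity q z : ℝ≥0∞) ≠ 0 := by simpa using hq
    rw [div_eq_mul_inv, ENNReal.coe_mul, mul_assoc] at hz
    exact (ENNReal.mul_right_inj hq' ENNReal.coe_ne_top).1 hz
  have key' := (measurePreserving_permuteFst (n := m + 2)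
    (Equiv.swap 0 1) P ν).quasiMeasurePreserving.ae key
  filter_upwards [key, key'] with z h1 h2 hq1 hq2
  rw [h1 hq1, ← hS (Equiv.swap 0 1), ← hN (Equiv.swap 0 1), ← h2 hq2]
  simp [permuteFst]

/-- The other `m` rows only contribute factors of the density. These are nonzero on a set of
positive measure, so for almost every first two rows suitable remaining rows exist. -/
theorem ae_eq_of_exchangeable_pair {m : ℕ} (P : Measure α) (ν : Measure β) [SigmaFinite P]
    [SigmaFinite ν] {q : α → β → ℝ≥0} (hq0 : P.prod ν {x | q x.1 x.2 ≠ 0} ≠ 0)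
    {u : α × β → ℝ≥0∞}
    (h : ∀ᵐ z ∂(Measure.pi fun _ : Fin (m + 2) => P.prod ν), tupleDensity q z ≠ 0 →
      tupleDensity q (permuteFst (Equiv.swap 0 1) z) ≠ 0 → u (z 0) = u ((z 1).1, (z 0).2)) :
    ∀ᵐ x ∂P.prod ν, ∀ᵐ x' ∂P.prod ν, q x.1 x.2 ≠ 0 → q x'.1 x'.2 ≠ 0 → q x'.1 x.2 ≠ 0 →
      q x.1 x'.2 ≠ 0 → u x = u (x'.1, x.2) := by
  have e1 := (measurePreserving_piFinSuccAbove (fun _ : Fin (m + 2) => P.prod ν) 0).symm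
  have e2 := (measurePreserving_piFinSuccAbove (fun _ : Fin (m + 1) => P.prod ν) 0).symm
  have hr : Measure.pi (fun _ : Fin m => P.prod ν)
      (Set.univ.pi fun _ => {x | q x.1 x.2 ≠ 0}) ≠ 0 := by
    rw [Measure.pi_pi]
    exact Finset.prod_ne_zero_iff.2 fun _ _ => hq0
  filter_upwards [Measure.ae_ae_of_ae_prod (e1.quasiMeasurePreserving.ae h)] with x hx
  filter_upwards [Measure.ae_ae_of_ae_prod (e2.quasiMeasurePreserving.ae hx)] with x' hx' h1 h2 h3 h4
  obtain ⟨r, hr, hr'⟩ := ((frequently_ae_mem_iff.2 hr).and_eventually hx').exists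
  have hprod : ∏ i, q (r i).1 (r i).2 ≠ 0 :=
    Finset.prod_ne_zero_iff.2 fun i _ => hr i (Set.mem_univ i)
  have hsw : ∀ i : Fin m, Equiv.swap (0 : Fin (m + 2)) 1 i.succ.succ = i.succ.succ := fun i =>
    Equiv.swap_apply_of_ne_of_ne (Fin.succ_ne_zero _)
      fun h => Fin.succ_ne_zero i (Fin.succ_injective _ h)
  simp only [MeasurableEquiv.piFinSuccAbove, tupleDensity, permuteFst, Fin.prod_univ_succ] at hr'
  simp [hsw] at hr'
  exact hr' h1 h2 hprod h3 h4 hprod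

/-- If `u (·, y)` agrees at exchangeable pairs of rows, then for almost every `y` it is almost
everywhere constant on the set where `q (· , y)` is positive. -/
theorem ae_ae_eq_of_pair (P : Measure α) (ν : Measure β) [SigmaFinite P]
    [SigmaFinite ν] {q : α → β → ℝ≥0} (hq : Measurable fun x : α × β => q x.1 x.2)
    {u : α × β → ℝ≥0∞} (hu : Measurable u)
    (h : ∀ᵐ x ∂P.prod ν, ∀ᵐ x' ∂P.prod ν, q x.1 x.2 ≠ 0 → q x'.1 x'.2 ≠ 0 → q x'.1 x.2 ≠ 0 →
      q x.1 x'.2 ≠ 0 → u x = u (x'.1, x.2)) :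
    ∀ᵐ y ∂ν, ∀ᵐ a ∂P.prod P, q a.1 y ≠ 0 → q a.2 y ≠ 0 → u (a.1, y) = u (a.2, y) := by
  -- The auxiliary response of the second row has to be found in `T (a, a')`, which is possible when
  -- this set has positive measure.
  let T : α × α → Set β := fun a => {y | q a.1 y ≠ 0 ∧ q a.2 y ≠ 0}
  have hT : Measurable fun a : α × α => ν (T a) := by
    have hm : MeasurableSet {x : (α × α) × β | q x.1.1 x.2 ≠ 0 ∧ q x.1.2 x.2 ≠ 0} := by
      have h1 : Measurable fun x : (α × α) × β => q x.1.1 x.2 :=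
        hq.comp ((measurable_fst.comp measurable_fst).prodMk measurable_snd)
      have h2 : Measurable fun x : (α × α) × β => q x.1.2 x.2 :=
        hq.comp ((measurable_snd.comp measurable_fst).prodMk measurable_snd)
      exact (h1 (measurableSet_singleton 0).compl).inter (h2 (measurableSet_singleton 0).compl)
    exact measurable_measure_prodMk_left hm
  have hQ : MeasurableSet {x : (α × α) × β |
      q x.1.1 x.2 ≠ 0 → q x.1.2 x.2 ≠ 0 → u (x.1.1, x.2) = u (x.1.2, x.2)} := by
    have h1 : Measurable fun x : (α × α) × β => (x.1.1, x.2) := by fun_prop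
    have h2 : Measurable fun x : (α × α) × β => (x.1.2, x.2) := by fun_prop
    have m1 := (hq.comp h1) (measurableSet_singleton 0)
    have m2 := (hq.comp h2) (measurableSet_singleton 0)
    have m3 := measurableSet_eq_fun (hu.comp h1) (hu.comp h2)
    convert (m1.union m2).union m3 using 1
    ext x
    simp only [Set.mem_ofPred_eq, Set.mem_union, Set.mem_preimage, Function.comp,
      Set.mem_singleton_iff]
    tauto
  have step : ∀ᵐ a ∂P, ∀ᵐ z ∂P.prod ν,
      q a z.2 ≠ 0 → q z.1 z.2 ≠ 0 → u (a, z.2) = u (z.1, z.2) := by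
    filter_upwards [Measure.ae_ae_of_ae_prod h] with a ha
    have hQa : MeasurableSet {z : α × β | q a z.2 ≠ 0 → q z.1 z.2 ≠ 0 → u (a, z.2) = u (z.1, z.2)} :=
      (show Measurable fun z : α × β => ((a, z.1), z.2) by fun_prop) hQ
    have hTa : Measurable fun z : α × β => ν (T (a, z.1)) :=
      hT.comp (show Measurable fun z : α × β => (a, z.1) by fun_prop)
    have hswap : ∀ᵐ y ∂ν, ∀ᵐ a' ∂P, ν (T (a, a')) ≠ 0 →
        q a y ≠ 0 → q a' y ≠ 0 → u (a, y) = u (a', y) := by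
      filter_upwards [ha] with y hy
      filter_upwards [Measure.ae_ae_of_ae_prod hy] with a' ha' hpos h1 h2
      obtain ⟨y', hy', hy''⟩ := ((frequently_ae_mem_iff.2 hpos).and_eventually ha').exists
      exact hy'' h1 hy'.2 h2 hy'.1
    have hm : MeasurableSet {z : α × β | ν (T (a, z.1)) ≠ 0 →
        q a z.2 ≠ 0 → q z.1 z.2 ≠ 0 → u (a, z.2) = u (z.1, z.2)} := by
      convert (hTa (measurableSet_singleton 0)).union hQa using 1
      ext z
      simp only [Set.mem_ofPred_eq, Set.mem_union, Set.mem_preimage, Set.mem_singleton_iff]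
      tauto
    refine (Measure.ae_prod_iff_ae_ae hQa).2 ?_
    filter_upwards [(Measure.ae_ae_comm (p := fun a' y => ν (T (a, a')) ≠ 0 →
      q a y ≠ 0 → q a' y ≠ 0 → u (a, y) = u (a', y)) hm).2 hswap] with a' ha'
    -- With both attributes fixed, a null `T (a, a')` makes the claim vacuous for almost every `y`.
    by_cases h0 : ν (T (a, a')) = 0
    · filter_upwards [measure_eq_zero_iff_ae_notMem.1 h0] with y hy h1 h2
      exact absurd ⟨h1, h2⟩ hy
    · filter_upwards [ha'] with y hy using hy h0
  have hA : MeasurableSet {x : α × α × β |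
      q x.1 x.2.2 ≠ 0 → q x.2.1 x.2.2 ≠ 0 → u (x.1, x.2.2) = u (x.2.1, x.2.2)} :=
    (show Measurable fun x : α × α × β => ((x.1, x.2.1), x.2.2) by fun_prop) hQ
  have hprod := (Measure.ae_prod_iff_ae_ae hA).2 step
  have hassoc := (measurePreserving_prodAssoc P P ν).quasiMeasurePreserving.ae hprod
  exact (Measure.ae_ae_comm (p := fun (a : α × α) y =>
    q a.1 y ≠ 0 → q a.2 y ≠ 0 → u (a.1, y) = u (a.2, y)) hQ).1 (Measure.ae_ae_of_ae_prod hassoc)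

/-- Both sides are double integrals of `q a.1 * q a.2` over `a.1 ∈ t`, weighted by `u a.1` on the
left and by `u a.2` on the right. -/
theorem lintegral_mul_lintegral_eq_of_pair (P : Measure α) [SFinite P] {q u : α → ℝ≥0∞}
    (hq : Measurable q) (hu : Measurable u) (t : Set α)
    (h : ∀ᵐ a ∂P.prod P, q a.1 ≠ 0 → q a.2 ≠ 0 → u a.1 = u a.2) :
    (∫⁻ a in t, q a * u a ∂P) * ∫⁻ a, q a ∂P = (∫⁻ a in t, q a ∂P) * ∫⁻ a, q a * u a ∂P := by
  have hqu : Measurable fun a => q a * u a := hq.mul hu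
  rw [← lintegral_prod_mul hqu.aemeasurable hq.aemeasurable,
    ← lintegral_prod_mul hq.aemeasurable hqu.aemeasurable]
  have hac : (P.restrict t).prod P ≪ P.prod P :=
    Measure.restrict_le_self.absolutelyContinuous.prod .rfl
  refine lintegral_congr_ae ?_
  filter_upwards [hac.ae_le h] with a ha
  by_cases h1 : q a.1 = 0
  · simp [h1]
  by_cases h2 : q a.2 = 0
  · simp [h2]
  rw [ha h1 h2]; ring

end Exchange

/-! ### Invariant sets and the σ-algebra of unordered rows -/

section UnorderedRows

variable {α β : Type*}

theorem unorderedRows_permute {n : ℕ} (a : Fin n → α) (π : Equiv.Perm (Fin n)) :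
    unorderedRows (fun i => a (π i)) = unorderedRows a := by
  unfold unorderedRows
  conv_rhs => rw [← Multiset.map_univ_val_equiv π, Multiset.map_map]
  rfl

/-- Equal multiplicities give bijections between the fibres over each value, and these glue to a
permutation. -/
theorem exists_perm_of_unorderedRows_eq {n : ℕ} {a b : Fin n → α}
    (h : unorderedRows a = unorderedRows b) : ∃ π : Equiv.Perm (Fin n), ∀ i, b (π i) = a i := by
  classical
  have e : ∀ c, Nonempty ({i // a i = c} ≃ {i // b i = c}) := fun c => by
    have hc := congrArg (Multiset.count c) h
    simp only [unorderedRows, Multiset.count_map] at hc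
    refine ⟨Fintype.equivOfCardEq ?_⟩
    rw [Fintype.card_subtype, Fintype.card_subtype]
    simpa only [eq_comm, Finset.card, Finset.filter_val] using hc
  exact ⟨Equiv.ofFiberEquiv fun c => (e c).some, fun i => Equiv.ofFiberEquiv_map _ i⟩

variable [MeasurableSpace α] [MeasurableSpace β]

/-- The σ-algebra on tuples of pairs generated by the second components and the unordered
collection of the first components. -/
abbrev sndRowsMeasurableSpace (n : ℕ) (α β : Type*) [MeasurableSpace α] [MeasurableSpace β] :
    MeasurableSpace (Fin n → α × β) :=
  MeasurableSpace.comap (fun z i => (z i).2) inferInstance ⊔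
    MeasurableSpace.comap (fun z => unorderedRows fun i => (z i).1) (rowsMeasurableSpace n α)

/-- Preimages under a symmetric function are unions of orbits, hence preimages of sets of multisets;
the quotient σ-algebra contains those sets by definition. -/
theorem measurable_comp_unorderedRows {n : ℕ} {γ : Type*} [MeasurableSpace γ]
    {F : (Fin n → α) → γ} (hF : Measurable F)
    (hsymm : ∀ (π : Equiv.Perm (Fin n)) a, F (fun i => a (π i)) = F a) :
    Measurable[MeasurableSpace.comap (unorderedRows (n := n)) (rowsMeasurableSpace n α)] F := by
  intro U hU
  have h : unorderedRows ⁻¹' (unorderedRows '' (F ⁻¹' U)) = F ⁻¹' U := by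
    refine Set.Subset.antisymm ?_ (Set.subset_preimage_image _ _)
    rintro a ⟨b, hb, hba⟩
    obtain ⟨π, hπ⟩ := exists_perm_of_unorderedRows_eq hba
    have : b = fun i => a (π i) := funext fun i => (hπ i).symm
    rwa [Set.mem_preimage, this, hsymm] at hb
  refine ⟨unorderedRows '' (F ⁻¹' U), ?_, h⟩
  change MeasurableSet (unorderedRows ⁻¹' (unorderedRows '' (F ⁻¹' U)))
  rw [h]
  exact hF hU

theorem sndRowsMeasurableSpace_le_invariants (n : ℕ) (π : Equiv.Perm (Fin n)) :
    sndRowsMeasurableSpace n α β ≤ MeasurableSpace.invariants (permuteFst π) := by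
  refine sup_le ?_ ?_
  · rintro _ ⟨C, hC, rfl⟩
    have hm : Measurable fun (z : Fin n → α × β) i => (z i).2 := by fun_prop
    exact ⟨hm hC, rfl⟩
  · rintro _ ⟨B, hB, rfl⟩
    have hm : Measurable fun (z : Fin n → α × β) i => (z i).1 := by fun_prop
    refine ⟨hm (show MeasurableSet (unorderedRows ⁻¹' B) from hB), ?_⟩
    ext z
    change unorderedRows (fun i => (z (π i)).1) ∈ B ↔ unorderedRows (fun i => (z i).1) ∈ B
    rw [unorderedRows_permute (fun i => (z i).1) π]

theorem sndRowsMeasurableSpace_le (n : ℕ) :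
    sndRowsMeasurableSpace n α β ≤ MeasurableSpace.pi :=
  (sndRowsMeasurableSpace_le_invariants n 1).trans (MeasurableSpace.invariants_le _)

/-- Averaging over the orbit recovers an invariant set. The orbit measure of a rectangle is a
symmetric function of the first components times an indicator of the second ones, hence measurable
for the small σ-algebra. A π-λ argument extends this to all measurable sets. -/
theorem measurableSet_sndRows_of_invariant {n : ℕ} {D : Set (Fin n → α × β)}
    (hD : MeasurableSet D) (hinv : ∀ π, permuteFst π ⁻¹' D = D) :
    MeasurableSet[sndRowsMeasurableSpace n α β] D := by
  let split : (Fin n → α × β) → (Fin n → α) × (Fin n → β) :=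
    fun z => (fun i => (z i).1, fun i => (z i).2)
  let zip : (Fin n → α) × (Fin n → β) → Fin n → α × β := fun x i => (x.1 i, x.2 i)
  have hzip : Measurable zip := by unfold zip; fun_prop
  let κ : (Fin n → α × β) → Measure ((Fin n → α) × (Fin n → β)) := fun z =>
    ∑ π, Measure.dirac (split (permuteFst π z))
  have hfin : ∀ z, IsFiniteMeasure (κ z) := fun z => by unfold κ; infer_instance
  have hrect : ∀ (s : Set (Fin n → α)) (t : Set (Fin n → β)), MeasurableSet s → MeasurableSet t →
      Measurable[sndRowsMeasurableSpace n α β] fun z => κ z (s ×ˢ t) := by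
    intro s t hs ht
    let F : (Fin n → α) → ℝ≥0∞ := fun a =>
      ∑ π : Equiv.Perm (Fin n), s.indicator 1 fun i => a (π i)
    have hFm : Measurable F := Finset.measurable_sum _ fun π _ =>
      (measurable_one.indicator hs).comp (by fun_prop)
    have hF := measurable_comp_unorderedRows hFm fun π a =>
      Equiv.sum_comp (Equiv.mulLeft π) fun σ : Equiv.Perm (Fin n) =>
        s.indicator (1 : (Fin n → α) → ℝ≥0∞) fun i => a (σ i)
    have h1 : Measurable[sndRowsMeasurableSpace n α β]
        fun z : Fin n → α × β => F fun i => (z i).1 := by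
      refine Measurable.mono ?_ le_sup_right le_rfl
      intro U hU
      obtain ⟨B, hB, hBU⟩ := hF hU
      exact ⟨B, hB, by ext z; exact Set.ext_iff.1 hBU fun i => (z i).1⟩
    have h2 : Measurable[sndRowsMeasurableSpace n α β]
        fun z : Fin n → α × β => t.indicator (1 : (Fin n → β) → ℝ≥0∞) fun i => (z i).2 := by
      refine Measurable.mono ?_ le_sup_left le_rfl
      exact (measurable_one.indicator ht).comp (comap_measurable _)
    convert h1.mul h2 using 2 with z
    simp only [κ, Measure.coe_finsetSum, Finset.sum_apply, Measure.dirac_apply' _ (hs.prod ht), F,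
      Pi.mul_apply, Finset.sum_mul]
    refine Finset.sum_congr rfl fun π _ => ?_
    by_cases hs' : (fun i => (z (π i)).1) ∈ s <;> by_cases ht' : (fun i => (z i).2) ∈ t <;>
      simp [split, permuteFst, hs', ht']
  have hκ : Measurable[sndRowsMeasurableSpace n α β] κ := by
    refine @Measurable.measure_of_isPiSystem _ _ (sndRowsMeasurableSpace n α β) _ κ hfin _
      generateFrom_prod.symm isPiSystem_prod ?_ ?_
    · rintro _ ⟨s, hs, t, ht, rfl⟩
      exact hrect s t hs ht
    · rw [← Set.univ_prod_univ]
      exact hrect _ _ .univ .univ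
  have hval : ∀ z, κ z (zip ⁻¹' D) = (Fintype.card (Equiv.Perm (Fin n)) : ℝ≥0∞) * D.indicator 1 z := by
    intro z
    have : ∀ π, Measure.dirac (split (permuteFst π z)) (zip ⁻¹' D) = D.indicator 1 z := by
      intro π
      rw [Measure.dirac_apply' _ (hzip hD)]
      have h : zip (split (permuteFst π z)) ∈ D ↔ z ∈ D := by
        conv_rhs => rw [← hinv π]
        rfl
      by_cases hz : z ∈ D <;> simp [hz, h]
    simp [κ, this]
  -- On an invariant set the orbit measure is either `n!` or zero, whether or not rows coincide.
  have hDeq : D = (fun z => κ z (zip ⁻¹' D)) ⁻¹' {0}ᶜ := by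
    ext z
    by_cases hz : z ∈ D <;> simp [hval, hz]
  rw [hDeq]
  exact (Measure.measurable_coe (hzip hD)).comp hκ (measurableSet_singleton 0).compl

theorem measurable_sndRows_of_invariant {n : ℕ} {γ : Type*} [MeasurableSpace γ]
    {F : (Fin n → α × β) → γ} (hF : Measurable F) (hinv : ∀ π z, F (permuteFst π z) = F z) :
    Measurable[sndRowsMeasurableSpace n α β] F := fun U hU =>
  measurableSet_sndRows_of_invariant (hF hU) fun π => by
    ext z; simp [hinv]

end UnorderedRows

/-! ### Conditional independence given the responses and the unordered attributes -/

namespace Setting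

variable {𝒳 : Type u} {𝒴 : Type v} {Ω : Type w} [MeasurableSpace 𝒳] [MeasurableSpace 𝒴]
  [MeasurableSpace Ω] {n p d : ℕ} (M : Setting 𝒳 𝒴 Ω n p d)

theorem sigmaYRows_eq_comap_pairs :
    M.sigmaYRows = (sndRowsMeasurableSpace n (Fin p → ℝ) 𝒴).comap M.pairs := by
  rw [sndRowsMeasurableSpace, MeasurableSpace.comap_sup, MeasurableSpace.comap_comp,
    MeasurableSpace.comap_comp]
  rfl

theorem sigmaYRows_le : M.sigmaYRows ≤ (inferInstance : MeasurableSpace Ω) := by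
  rw [sigmaYRows_eq_comap_pairs]
  exact (MeasurableSpace.comap_mono (sndRowsMeasurableSpace_le n)).trans
    M.measurable_pairs.comap_le

/-- The conditional probability of `𝐀̃ ∈ t` given the data. -/
noncomputable def tildeProb (t : Set (Fin n → Fin p → ℝ)) (z : Fin n → (Fin p → ℝ) × 𝒴) : ℝ≥0 :=
  ∑ π, M.weight π z * t.indicator 1 (fun i => (permuteFst π z i).1)

theorem measurable_tildeProb {t : Set (Fin n → Fin p → ℝ)} (ht : MeasurableSet t) :
    Measurable (M.tildeProb t) := by
  refine Finset.measurable_sum _ fun π _ => (M.measurable_weight π).mul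
    ((measurable_one.indicator ht).comp ?_)
  have := measurable_permuteFst (α := Fin p → ℝ) (β := 𝒴) π
  fun_prop

theorem tildeProb_permuteFst (t : Set (Fin n → Fin p → ℝ)) (σ : Equiv.Perm (Fin n))
    (z : Fin n → (Fin p → ℝ) × 𝒴) : M.tildeProb t (permuteFst σ z) = M.tildeProb t z := by
  unfold tildeProb weight
  simp only [icpProb_permuteFst, permuteFst_permuteFst]
  exact Equiv.sum_comp (Equiv.mulLeft σ) fun π =>
    icpProb M.q (fun i => (z i).1) (fun i => (z i).2) π *
      t.indicator (1 : (Fin n → Fin p → ℝ) → ℝ≥0) (fun i => (permuteFst π z i).1)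

/-- A crude bound, sufficient for integrability. -/
theorem tildeProb_le (t : Set (Fin n → Fin p → ℝ)) (z : Fin n → (Fin p → ℝ) × 𝒴) :
    M.tildeProb t z ≤ Fintype.card (Equiv.Perm (Fin n)) := by
  have h : ∀ π ∈ Finset.univ,
      M.weight π z * t.indicator 1 (fun i => (permuteFst π z i).1) ≤ 1 := fun π _ =>
    mul_le_one' (icpProb_le_one _ _ _ _)
      (Set.indicator_le_self' (f := (1 : (Fin n → Fin p → ℝ) → ℝ≥0)) (fun _ _ => zero_le) _)
  simpa [tildeProb] using Finset.sum_le_card_nsmul _ _ _ h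

theorem measurable_tildeProb_pairs {t : Set (Fin n → Fin p → ℝ)} (ht : MeasurableSet t) :
    Measurable[M.sigmaYRows] fun ω => M.tildeProb t (M.pairs ω) := by
  rw [sigmaYRows_eq_comap_pairs]
  exact (measurable_sndRows_of_invariant (M.measurable_tildeProb ht)
    (M.tildeProb_permuteFst t)).comp (comap_measurable _)

theorem integrable_tildeProb_mul {t : Set (Fin n → Fin p → ℝ)} (ht : MeasurableSet t)
    {S : Set (Fin n → Fin d → ℝ)} (hS : MeasurableSet S) :
    Integrable ((fun ω => (M.tildeProb t (M.pairs ω) : ℝ)) *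
      (M.sampleYhat ⁻¹' S).indicator fun _ => (1 : ℝ)) M.μ := by
  refine Integrable.bdd_mul (c := Fintype.card (Equiv.Perm (Fin n)))
    ((integrable_const 1).indicator (M.measurable_sampleYhat hS))
    ((M.measurable_tildeProb ht).comp M.measurable_pairs).coe_nnreal_real.aestronglyMeasurable
    (ae_of_all _ fun ω => ?_)
  simpa using (NNReal.coe_le_coe.2 (M.tildeProb_le t (M.pairs ω)))

variable {M}

/-- Equality in law replaces `𝐀` by `𝐀̃`. As `D` does not see the permutation, averaging over it
affects only the indicator of `t`. -/
theorem SameLaw.measure_inter_eq (h : M.SameLaw) {S : Set (Fin n → Fin d → ℝ)}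
    (hS : MeasurableSet S) {t : Set (Fin n → Fin p → ℝ)} (ht : MeasurableSet t)
    {D : Set (Fin n → (Fin p → ℝ) × 𝒴)}
    (hD : MeasurableSet[sndRowsMeasurableSpace n (Fin p → ℝ) 𝒴] D) :
    M.μ (M.sampleYhat ⁻¹' S ∩ M.sampleA ⁻¹' t ∩ M.pairs ⁻¹' D) =
      ∫⁻ ω in M.pairs ⁻¹' D ∩ M.sampleYhat ⁻¹' S, (M.tildeProb t (M.pairs ω) : ℝ≥0∞) ∂M.μ := by
  have hDm := sndRowsMeasurableSpace_le n D hD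
  have hinv : ∀ π z, permuteFst π z ∈ D ↔ z ∈ D := fun π z =>
    Set.ext_iff.1 (sndRowsMeasurableSpace_le_invariants n π D hD).2 z
  have hf : Measurable fun (z : Fin n → (Fin p → ℝ) × 𝒴) i => (z i).1 := by fun_prop
  have hT : MeasurableSet ((fun (z : Fin n → (Fin p → ℝ) × 𝒴) i => (z i).1) ⁻¹' t ∩ D) :=
    (hf ht).inter hDm
  rw [Set.inter_assoc]
  refine (h.measure_eq hS hT).trans ?_
  rw [M.measure_sampleYhat_pairsTilde hS hT, ← lintegral_finsetSum,
    ← Measure.restrict_restrict (M.measurable_pairs hDm), ← lintegral_indicator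
      (M.measurable_pairs hDm)]
  · refine lintegral_congr fun ω => ?_
    by_cases hω : M.pairs ω ∈ D
    · rw [Set.indicator_of_mem (by exact hω)]
      unfold tildeProb
      push_cast
      refine Finset.sum_congr rfl fun π _ => ?_
      congr 1
      by_cases hA : (fun i => (permuteFst π (M.pairs ω) i).1) ∈ t
      · rw [Set.indicator_of_mem hA, Set.indicator_of_mem (by exact ⟨hA, (hinv π _).2 hω⟩)]
        simp
      · rw [Set.indicator_of_notMem hA, Set.indicator_of_notMem fun hx => hA hx.1]
    · rw [Set.indicator_of_notMem (by exact hω)]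
      refine Finset.sum_eq_zero fun π _ => ?_
      rw [Set.indicator_of_notMem fun hx => hω ((hinv π _).1 hx.2), mul_zero]
  · intro π _
    exact ((M.measurable_weight π).comp M.measurable_pairs).coe_nnreal_ennreal.mul
      ((measurable_one.indicator hT).comp
        ((measurable_permuteFst π).comp M.measurable_pairs))

theorem SameLaw.condProb_inter (h : M.SameLaw) {S : Set (Fin n → Fin d → ℝ)}
    (hS : MeasurableSet S) {t : Set (Fin n → Fin p → ℝ)} (ht : MeasurableSet t) :
    M.μ⟦M.sampleYhat ⁻¹' S ∩ M.sampleA ⁻¹' t | M.sigmaYRows⟧ =ᵐ[M.μ]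
      fun ω => (M.tildeProb t (M.pairs ω) : ℝ) * (M.μ⟦M.sampleYhat ⁻¹' S | M.sigmaYRows⟧) ω := by
  have hle := M.sigmaYRows_le
  have hSm := M.measurable_sampleYhat hS
  have hE := hSm.inter (M.measurable_sampleA ht)
  have hint := M.integrable_tildeProb_mul ht hS
  have hG := (M.measurable_tildeProb_pairs ht).coe_nnreal_real.stronglyMeasurable
  refine EventuallyEq.trans (EventuallyEq.symm ?_) (condExp_mul_of_stronglyMeasurable_left hG hint
    ((integrable_const 1).indicator hSm))
  refine ae_eq_condExp_of_forall_setIntegral_eq hle ((integrable_const 1).indicator hE)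
    (fun _ _ _ => integrable_condExp.integrableOn) (fun E hEm _ => ?_)
    stronglyMeasurable_condExp.aestronglyMeasurable
  rw [setIntegral_condExp hle hint hEm, integral_indicator_const (1 : ℝ) hE, smul_eq_mul, mul_one,
    measureReal_restrict_apply hE]
  have hEm' := hEm
  rw [sigmaYRows_eq_comap_pairs] at hEm'
  obtain ⟨D, hD, rfl⟩ := hEm'
  have hDm : MeasurableSet (M.pairs ⁻¹' D) := hle _ hEm
  rw [measureReal_def, h.measure_inter_eq hS ht hD]
  have hind : ∀ ω, ((fun ω => (M.tildeProb t (M.pairs ω) : ℝ)) *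
      (M.sampleYhat ⁻¹' S).indicator fun _ => (1 : ℝ)) ω =
      (M.sampleYhat ⁻¹' S).indicator (fun ω => (M.tildeProb t (M.pairs ω) : ℝ)) ω := by
    intro ω
    by_cases hω : ω ∈ M.sampleYhat ⁻¹' S
    · rw [Pi.mul_apply, Set.indicator_of_mem hω, Set.indicator_of_mem hω, mul_one]
    · rw [Pi.mul_apply, Set.indicator_of_notMem hω, Set.indicator_of_notMem hω, mul_zero]
  have hm : Measurable fun ω => (M.tildeProb t (M.pairs ω) : ℝ) :=
    ((M.measurable_tildeProb ht).comp M.measurable_pairs).coe_nnreal_real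
  rw [integral_congr_ae (ae_of_all _ hind), setIntegral_indicator hSm,
    integral_eq_lintegral_of_nonneg_ae (ae_of_all _ fun ω => NNReal.coe_nonneg _)
      hm.aestronglyMeasurable]
  simp only [ENNReal.ofReal_coe_nnreal]

/-- The case of a trivial constraint on `𝐘̂` identifies `tildeProb` as the conditional probability
of `𝐀 ∈ t`. -/
theorem SameLaw.condIndepGiven (h : M.SameLaw) :
    CondIndepGiven M.sigmaYRows M.μ M.sampleYhat M.sampleA := by
  intro S t hS ht
  have h1 := h.condProb_inter hS ht
  have h2 := h.condProb_inter MeasurableSet.univ ht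
  have h3 : M.μ⟦M.sampleYhat ⁻¹' Set.univ | M.sigmaYRows⟧ = fun _ => (1 : ℝ) := by
    rw [Set.preimage_univ, Set.indicator_univ]
    exact condExp_const M.sigmaYRows_le 1
  rw [h3] at h2
  rw [Set.preimage_univ, Set.univ_inter] at h2
  filter_upwards [h1, h2] with ω h1 h2
  rw [h1, h2, mul_one, mul_comm]

end Setting

/-! ### Equalized odds and equality in law -/

namespace Setting

variable {𝒳 : Type u} {𝒴 : Type v} {Ω : Type w} [MeasurableSpace 𝒳] [MeasurableSpace 𝒴]
  [MeasurableSpace Ω] {n p d : ℕ} (M : Setting 𝒳 𝒴 Ω n p d)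

theorem measurableSet_yhat {s : Set (Fin d → ℝ)} (hs : MeasurableSet s) :
    MeasurableSet {x : 𝒳 × (Fin p → ℝ) × 𝒴 | M.f x.1 ∈ s} :=
  M.measurable_f.comp measurable_fst hs

theorem measurable_q_ennreal : Measurable fun z : (Fin p → ℝ) × 𝒴 => (M.q z.1 z.2 : ℝ≥0∞) :=
  M.measurable_q.coe_nnreal_ennreal

variable {M}

/-- Under equalized odds, the density of `(A, Y)` on the event `Ŷ ∈ s` is `q(y | a) κ(y)`. -/
theorem EqualizedOdds.exists_density (h : M.EqualizedOdds) {s : Set (Fin d → ℝ)}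
    (hs : MeasurableSet s) :
    ∃ κ : 𝒴 → ℝ≥0∞, Measurable κ ∧
      (M.law.restrict {x | M.f x.1 ∈ s}).map Prod.snd =
        M.base.withDensity fun z => M.q z.1 z.2 * κ z.2 := by
  have hY : Measurable fun x : 𝒳 × (Fin p → ℝ) × 𝒴 => x.2.2 := by fun_prop
  have hE := M.measurableSet_yhat hs
  obtain ⟨κ, hκ, hκt, hκe, -⟩ := exists_condProb_density M.law hY hE
  refine ⟨κ, hκ, ?_⟩
  have hq := M.measurable_q_ennreal
  have hκ2 : Measurable fun z : (Fin p → ℝ) × 𝒴 => κ z.2 := hκ.comp measurable_snd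
  have hmul : (M.base.withDensity fun z => M.q z.1 z.2 * κ z.2) =
      (M.base.withDensity fun z => (M.q z.1 z.2 : ℝ≥0∞)).withDensity fun z => κ z.2 :=
    withDensity_mul _ hq hκ2
  rw [hmul, ← M.map_snd_law]
  -- On a rectangle the claim is that the conditional probability of `Ŷ ∈ s, A ∈ B` given `Y` is the
  -- product of the two separate ones, integrated over `Y ∈ C`.
  refine Measure.ext_prod fun {B C} hB hC => ?_
  have hB' : MeasurableSet {x : 𝒳 × (Fin p → ℝ) × 𝒴 | x.2.1 ∈ B} :=
    (show Measurable fun x : 𝒳 × (Fin p → ℝ) × 𝒴 => x.2.1 by fun_prop) hB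
  obtain ⟨κB, hκB, hκBt, hκBe, hB2⟩ := exists_condProb_density M.law hY hB'
  obtain ⟨κEB, hκEB, hκEBt, hκEBe, hEB2⟩ := exists_condProb_density M.law hY (hE.inter hB')
  have hind := h s B hs hB
  have hae : ∀ᵐ x ∂M.law, κEB x.2.2 = κB x.2.2 * κ x.2.2 := by
    filter_upwards [hind, hκe, hκBe, hκEBe] with x h1 h2 h3 h4
    rw [← ENNReal.toReal_eq_toReal_iff' (hκEBt _) (ENNReal.mul_ne_top (hκBt _) (hκt _)),
      ENNReal.toReal_mul, ← h2, ← h3, ← h4, mul_comm]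
    exact h1
  have hae' : ∀ᵐ y ∂M.law.map fun x => x.2.2, κEB y = κB y * κ y :=
    (ae_map_iff hY.aemeasurable (measurableSet_eq_fun hκEB (hκB.mul hκ))).2 hae
  have hrect : (Prod.snd ⁻¹' B ×ˢ C : Set (𝒳 × (Fin p → ℝ) × 𝒴)) =
      (fun x => x.2.2) ⁻¹' C ∩ {x | x.2.1 ∈ B} := by
    ext x; simp [and_comm]
  calc (M.law.restrict {x | M.f x.1 ∈ s}).map Prod.snd (B ×ˢ C)
      = (M.law.restrict ({x | M.f x.1 ∈ s} ∩ {x | x.2.1 ∈ B})).map (fun x => x.2.2) C := by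
        rw [Measure.map_apply measurable_snd (hB.prod hC), Measure.map_apply hY hC,
          Measure.restrict_apply (hY hC), Measure.restrict_apply (measurable_snd (hB.prod hC)),
          hrect, Set.inter_assoc]
        exact congrArg (fun S => M.law ((fun x => x.2.2) ⁻¹' C ∩ S)) (Set.inter_comm _ _)
    _ = ∫⁻ y in C, κB y * κ y ∂M.law.map fun x => x.2.2 := by
        rw [hEB2, withDensity_apply _ hC]
        exact setLIntegral_congr_fun_ae hC (hae'.mono fun y hy _ => hy)
    _ = ∫⁻ y in C, κ y ∂(M.law.restrict {x | x.2.1 ∈ B}).map fun x => x.2.2 := by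
        rw [hB2, setLIntegral_withDensity_eq_setLIntegral_mul _ hκB hκ hC]
        rfl
    _ = ((M.law.map Prod.snd).withDensity fun z => κ z.2) (B ×ˢ C) := by
        rw [withDensity_apply _ (hB.prod hC), setLIntegral_map hC hκ hY,
          setLIntegral_map (hB.prod hC) hκ2 measurable_snd, Measure.restrict_restrict (hY hC),
          hrect]

theorem EqualizedOdds.sameLaw (h : M.EqualizedOdds) : M.SameLaw := by
  refine M.sameLaw_of_measure_eq fun s hs T hT => ?_
  choose κ hκ hd using fun i => h.exists_density (hs i)
  have hq := M.measurable_q_ennreal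
  have hg : ∀ i, Measurable fun z : (Fin p → ℝ) × 𝒴 => (M.q z.1 z.2 : ℝ≥0∞) * κ i z.2 := fun i =>
    hq.mul ((hκ i).comp measurable_snd)
  have key : (M.μ.restrict (M.sampleYhat ⁻¹' Set.univ.pi s)).map M.pairs =
      (M.μ.restrict (M.sampleYhat ⁻¹' Set.univ.pi s)).map M.pairsTilde := by
    rw [M.map_pairs_restrict hs hg hd, M.map_pairsTilde_restrict hs hg hd]
    congr 1
    funext z
    have hprod : ∀ π : Equiv.Perm (Fin n),
        ∏ i, ((M.q (permuteFst π z i).1 (permuteFst π z i).2 : ℝ≥0∞) * κ i (permuteFst π z i).2) =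
          (tupleDensity M.q (permuteFst π z) : ℝ≥0∞) * ∏ i, κ i (z i).2 := by
      intro π
      rw [Finset.prod_mul_distrib, tupleDensity, ENNReal.ofNNReal_finsetProd]
      rfl
    have h1 := hprod 1
    rw [permuteFst_one] at h1
    simp_rw [hprod]
    rw [h1, ← Finset.sum_mul, ← mul_assoc, ← ENNReal.ofNNReal_finsetSum, ← ENNReal.coe_mul]
    congr 2
    -- If the normalization vanishes, so does its term at the identity, and both densities are zero.
    by_cases h0 : ∑ σ, tupleDensity M.q (permuteFst σ z) = 0
    · have := (Finset.sum_eq_zero_iff.1 h0) 1 (Finset.mem_univ _)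
      rw [permuteFst_one] at this
      rw [this, zero_div, zero_mul]
    · rw [div_mul_cancel₀ _ h0]
  have e := DFunLike.congr_fun key T
  rw [Measure.map_apply M.measurable_pairs hT, Measure.map_apply M.measurable_pairsTilde hT,
    Measure.restrict_apply (M.measurable_pairs hT),
    Measure.restrict_apply (M.measurable_pairsTilde hT)] at e
  rwa [Set.inter_comm, Set.inter_comm (M.sampleYhat ⁻¹' _)]

/-- Otherwise the law of `(A, Y)` would be the zero measure. -/
theorem base_positive (M : Setting 𝒳 𝒴 Ω n p d) :
    M.law.snd.fst.prod M.ν {z | M.q z.1 z.2 ≠ 0} ≠ 0 := by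
  intro h0
  have h1 : M.law.map Prod.snd Set.univ = 0 := by
    rw [M.map_snd_law, withDensity_apply _ MeasurableSet.univ, Measure.restrict_univ,
      lintegral_eq_zero_iff M.measurable_q_ennreal]
    filter_upwards [measure_eq_zero_iff_ae_notMem.1 h0] with z hz
    simpa using hz
  rw [Measure.map_apply measurable_snd MeasurableSet.univ] at h1
  simp at h1

/-- The density of `(A, Y)` on the event `Ŷ ∈ s`, relative to the law of `(A, Y)`. -/
theorem exists_density (M : Setting 𝒳 𝒴 Ω n p d) (s : Set (Fin d → ℝ)) :
    ∃ u : (Fin p → ℝ) × 𝒴 → ℝ≥0∞, Measurable u ∧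
      (M.law.restrict {x | M.f x.1 ∈ s}).map Prod.snd =
        M.base.withDensity fun z => M.q z.1 z.2 * u z := by
  have hac : (M.law.restrict {x | M.f x.1 ∈ s}).map Prod.snd ≪ M.law.map Prod.snd :=
    (Measure.absolutelyContinuous_of_le Measure.restrict_le_self).map measurable_snd
  refine ⟨_, Measure.measurable_rnDeriv ((M.law.restrict {x | M.f x.1 ∈ s}).map Prod.snd)
    (M.law.map Prod.snd), ?_⟩
  have h := Measure.withDensity_rnDeriv_eq _ _ hac
  conv_lhs => rw [← h]
  conv_lhs => enter [1]; rw [M.map_snd_law]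
  exact (withDensity_mul _ M.measurable_q_ennreal (Measure.measurable_rnDeriv _ _)).symm

theorem map_response_restrict (M : Setting 𝒳 𝒴 Ω n p d) {s : Set (Fin d → ℝ)}
    {G : (Fin p → ℝ) × 𝒴 → ℝ≥0∞} (hG : Measurable G)
    (h : (M.law.restrict {x | M.f x.1 ∈ s}).map Prod.snd = M.base.withDensity G)
    {t : Set (Fin p → ℝ)} (ht : MeasurableSet t) :
    (M.law.restrict ({x | M.f x.1 ∈ s} ∩ {x | x.2.1 ∈ t})).map (fun x => x.2.2) =
      M.ν.withDensity fun y => ∫⁻ a in t, G (a, y) ∂M.law.snd.fst := by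
  have ht' : MeasurableSet {x : 𝒳 × (Fin p → ℝ) × 𝒴 | x.2.1 ∈ t} :=
    (show Measurable fun x : 𝒳 × (Fin p → ℝ) × 𝒴 => x.2.1 by fun_prop) ht
  rw [← map_snd_restrict_fst_withDensity _ _ hG ht, ← base, ← h,
    Measure.restrict_map measurable_snd (measurable_fst ht),
    Measure.map_map measurable_snd measurable_snd,
    Measure.restrict_restrict (measurable_snd (measurable_fst ht)), Set.inter_comm]
  rfl

/-- With at least two observations, the equality in law forces equalized odds. -/
theorem SameLaw.equalizedOdds {m : ℕ} {M : Setting 𝒳 𝒴 Ω (m + 2) p d} (h : M.SameLaw) :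
    M.EqualizedOdds := by
  intro s t hs ht
  have hY : Measurable fun x : 𝒳 × (Fin p → ℝ) × 𝒴 => x.2.2 := by fun_prop
  have hq := M.measurable_q_ennreal
  obtain ⟨u, hu, hud⟩ := M.exists_density s
  have hqu : Measurable fun z : (Fin p → ℝ) × 𝒴 => (M.q z.1 z.2 : ℝ≥0∞) * u z := hq.mul hu
  have hq1 : (M.law.restrict {x | M.f x.1 ∈ Set.univ}).map Prod.snd =
      M.base.withDensity fun z => (M.q z.1 z.2 : ℝ≥0∞) := by
    simpa using M.map_snd_law
  have hpair : ∀ᵐ z ∂(Measure.pi fun _ : Fin (m + 2) => M.base),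
      (tupleDensity M.q z : ℝ≥0∞) * u (z 0) =
        ((tupleDensity M.q z / ∑ σ, tupleDensity M.q (permuteFst σ z) : ℝ≥0) : ℝ≥0∞) *
          ∑ π, (tupleDensity M.q (permuteFst π z) : ℝ≥0∞) * u (permuteFst π z 0) := by
    -- Constraining only the first prediction makes the product density `Q(z) u(z₀)`.
    let S : Fin (m + 2) → Set (Fin d → ℝ) := Fin.cons s fun _ => Set.univ
    let g : Fin (m + 2) → (Fin p → ℝ) × 𝒴 → ℝ≥0∞ :=
      Fin.cons (fun z => M.q z.1 z.2 * u z) fun _ z => M.q z.1 z.2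
    have hS : ∀ i, MeasurableSet (S i) := Fin.cases hs fun _ => MeasurableSet.univ
    have hg : ∀ i, Measurable (g i) := Fin.cases hqu fun _ => hq
    have hd : ∀ i, (M.law.restrict {x | M.f x.1 ∈ S i}).map Prod.snd = M.base.withDensity (g i) :=
      Fin.cases hud fun _ => hq1
    have hprod : ∀ z, ∏ i, g i (z i) = (tupleDensity M.q z : ℝ≥0∞) * u (z 0) := by
      intro z
      rw [tupleDensity, Fin.prod_univ_succ (n := m + 1) fun i => M.q (z i).1 (z i).2,
        Fin.prod_univ_succ (n := m + 1) fun i => g i (z i), ENNReal.coe_mul,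
        ENNReal.ofNNReal_finsetProd]
      simp only [g, Fin.cons_zero, Fin.cons_succ]
      ring
    have e1 := M.map_pairs_restrict hS hg hd
    have e2 := M.map_pairsTilde_restrict hS hg hd
    have key : (M.μ.restrict (M.sampleYhat ⁻¹' Set.univ.pi S)).map M.pairs =
        (M.μ.restrict (M.sampleYhat ⁻¹' Set.univ.pi S)).map M.pairsTilde := by
      ext T hT
      rw [Measure.map_apply M.measurable_pairs hT, Measure.map_apply M.measurable_pairsTilde hT,
        Measure.restrict_apply (M.measurable_pairs hT),
        Measure.restrict_apply (M.measurable_pairsTilde hT), Set.inter_comm,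
        Set.inter_comm (M.pairsTilde ⁻¹' T)]
      exact h.measure_eq (MeasurableSet.univ_pi hS) hT
    rw [e1, e2] at key
    simp only [hprod] at key
    have hqm := measurable_tupleDensity (n := m + 2) M.measurable_q
    have hm1 : Measurable fun z : Fin (m + 2) → (Fin p → ℝ) × 𝒴 =>
        (tupleDensity M.q z : ℝ≥0∞) * u (z 0) :=
      hqm.coe_nnreal_ennreal.mul (hu.comp (measurable_pi_apply 0))
    have hm2 : Measurable fun z : Fin (m + 2) → (Fin p → ℝ) × 𝒴 =>
        ((tupleDensity M.q z / ∑ σ, tupleDensity M.q (permuteFst σ z) : ℝ≥0) : ℝ≥0∞) *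
          ∑ π, (tupleDensity M.q (permuteFst π z) : ℝ≥0∞) * u (permuteFst π z 0) :=
      (hqm.div (Finset.measurable_sum _ fun σ _ =>
        hqm.comp (measurable_permuteFst σ))).coe_nnreal_ennreal.mul
        (Finset.measurable_sum _ fun π _ => hm1.comp (measurable_permuteFst π))
    exact (withDensity_eq_iff_of_sigmaFinite hm1.aemeasurable hm2.aemeasurable).1 key
  have hconst := ae_ae_eq_of_pair _ _ M.measurable_q hu
    (ae_eq_of_exchangeable_pair _ _ M.base_positive (ae_eq_of_exchangeable M.law.snd.fst M.ν hpair))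
  let P := M.law.snd.fst
  have hE := M.measurableSet_yhat hs
  have hB : MeasurableSet {x : 𝒳 × (Fin p → ℝ) × 𝒴 | x.2.1 ∈ t} :=
    (show Measurable fun x : 𝒳 × (Fin p → ℝ) × 𝒴 => x.2.1 by fun_prop) ht
  obtain ⟨κE, hκE, hκEt, hκEe, hE2⟩ := exists_condProb_density M.law hY hE
  obtain ⟨κB, hκB, hκBt, hκBe, hB2⟩ := exists_condProb_density M.law hY hB
  obtain ⟨κEB, hκEB, hκEBt, hκEBe, hEB2⟩ := exists_condProb_density M.law hY (hE.inter hB)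
  -- `N` is the marginal density of `Y`. Each conditional probability given `Y` is a density
  -- relative to `ν` divided by `N`.
  let N : 𝒴 → ℝ≥0∞ := fun y => ∫⁻ a, M.q a y ∂P
  have hN : Measurable N := Measurable.lintegral_prod_left' hq
  have hNlaw : M.law.map (fun x => x.2.2) = M.ν.withDensity N := by
    have := M.map_response_restrict hq hq1 MeasurableSet.univ
    simpa using this
  have ratio : ∀ {E : Set (𝒳 × (Fin p → ℝ) × 𝒴)} {κ N' : 𝒴 → ℝ≥0∞}, Measurable κ →
      Measurable N' → (M.law.restrict E).map (fun x => x.2.2) =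
        (M.law.map fun x => x.2.2).withDensity κ →
      (M.law.restrict E).map (fun x => x.2.2) = M.ν.withDensity N' →
      ∀ᵐ y ∂M.ν, N y * κ y = N' y := by
    intro E κ N' hκ hN' h1 h2
    rw [h2, hNlaw, ← withDensity_mul _ hN hκ] at h1
    exact (withDensity_eq_iff_of_sigmaFinite (hN.mul hκ).aemeasurable hN'.aemeasurable).1 h1.symm
  have hNt : ∀ {G : (Fin p → ℝ) × 𝒴 → ℝ≥0∞} (t : Set (Fin p → ℝ)), Measurable G →
      Measurable fun y => ∫⁻ a in t, G (a, y) ∂P := fun t hG =>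
    Measurable.lintegral_prod_left' hG
  have rEB := ratio hκEB (hNt t hqu) hEB2 (M.map_response_restrict hqu hud ht)
  have rE := ratio hκE (hNt Set.univ hqu) hE2
    (by simpa using M.map_response_restrict hqu hud MeasurableSet.univ)
  have rB := ratio hκB (hNt t hq) hB2 (by simpa using M.map_response_restrict hq hq1 ht)
  have hNfin : ∀ᵐ y ∂M.ν, N y < ∞ := by
    refine ae_lt_top hN ?_
    rw [← setLIntegral_univ, ← withDensity_apply _ MeasurableSet.univ, ← hNlaw]
    exact measure_ne_top _ _
  have hprod : ∀ᵐ y ∂M.ν, N y ≠ 0 → κEB y = κE y * κB y := by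
    filter_upwards [hconst, rEB, rE, rB, hNfin] with y hy h1 h2 h3 h4 h0
    have hqy : Measurable fun a => (M.q a y : ℝ≥0∞) := hq.comp measurable_prodMk_right
    have huy : Measurable fun a => u (a, y) := hu.comp measurable_prodMk_right
    have := lintegral_mul_lintegral_eq_of_pair P hqy huy t
      (hy.mono fun a ha h1 h2 => ha (by simpa using h1) (by simpa using h2))
    rw [Measure.restrict_univ] at h2
    rw [← h1, ← h2, ← h3] at this
    have e : N y * N y * κEB y = N y * N y * (κE y * κB y) := by
      calc N y * N y * κEB y = N y * κEB y * N y := by ring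
        _ = N y * κB y * (N y * κE y) := this
        _ = _ := by ring
    exact (ENNReal.mul_right_inj (mul_ne_zero h0 h0) (ENNReal.mul_ne_top h4.ne h4.ne)).1 e
  -- The set where `N` vanishes is null for the law of `Y`.
  have hlaw : ∀ᵐ y ∂M.law.map (fun x => x.2.2), κEB y = κE y * κB y := by
    rw [hNlaw]
    exact (ae_withDensity_iff hN).2 hprod
  filter_upwards [hκEe, hκBe, hκEBe, ae_of_ae_map hY.aemeasurable hlaw] with x h1 h2 h3 h4
  refine h3.trans ?_
  rw [h4, ENNReal.toReal_mul]
  exact (congrArg₂ (· * ·) h1 h2).symm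

theorem EqualizedOdds.cdfGap_ae_eq_zero (h : M.EqualizedOdds) (t₁ : Fin d → ℝ) (t₂ : Fin p → ℝ) :
    M.cdfGap t₁ t₂ =ᵐ[M.law] 0 := by
  filter_upwards [h (Set.Iic t₁) (Set.Iic t₂) measurableSet_Iic measurableSet_Iic] with z hz
  exact sub_eq_zero.2 hz

end Setting

end FairICP

/-! ### The theorem -/

theorem theorem2p1 :
    (∀ (𝒳 : Type u) (𝒴 : Type v) (Ω : Type w)
        [MeasurableSpace 𝒳] [MeasurableSpace 𝒴] [MeasurableSpace Ω]
        (n p d : ℕ) (M : FairICP.Setting 𝒳 𝒴 Ω n p d),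
      (M.EqualizedOdds → M.SameLaw) ∧
      (M.SameLaw → FairICP.CondIndepGiven M.sigmaYRows M.μ M.sampleYhat M.sampleA)) ∧
    (∀ (𝒳 : ℕ → Type u) (𝒴 : ℕ → Type v) (Ω : ℕ → Type w)
        [∀ n, MeasurableSpace (𝒳 n)] [∀ n, MeasurableSpace (𝒴 n)] [∀ n, MeasurableSpace (Ω n)]
        (p d : ℕ → ℕ) (M : ∀ n, FairICP.Setting (𝒳 n) (𝒴 n) (Ω n) n (p n) (d n)),
      (∀ᶠ n in atTop, (M n).SameLaw) →
      Tendsto (fun n => Real.log (p n) / (n : ℝ)) atTop (𝓝 0) →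
      ∀ (t₁ : ∀ n, Fin (d n) → ℝ) (t₂ : ∀ n, Fin (p n) → ℝ),
        Tendsto (fun n => eLpNorm ((M n).cdfGap (t₁ n) (t₂ n)) ∞ (M n).law) atTop (𝓝 0)) := by
  refine ⟨fun 𝒳 𝒴 Ω _ _ _ n p d M => ⟨fun h => h.sameLaw, fun h => h.condIndepGiven⟩, ?_⟩
  intro 𝒳 𝒴 Ω _ _ _ p d M hM _ t₁ t₂
  have odds : ∀ n, 2 ≤ n → (M n).SameLaw → (M n).EqualizedOdds := by
    intro n hn h
    obtain ⟨m, rfl⟩ := Nat.exists_eq_add_of_le' hn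
    exact h.equalizedOdds
  -- The essential supremum is eventually equal to zero, not merely small.
  refine tendsto_const_nhds.congr' ?_
  filter_upwards [hM, eventually_ge_atTop 2] with n h hn
  rw [eLpNorm_congr_ae ((odds n hn h).cdfGap_ae_eq_zero _ _), eLpNorm_zero]
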